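/- **Setting.** Let $\mathcal G$ be a finite connected undirected graph on $N$ nodes, let $\mathcal A$ be the set of its directed arcs (both orientations of every edge), and $M\ge 0$. For each node $i$ let $g_i:\mathbb R^M\to\mathbb R$ be convex and differentiable, and $h_i:\mathbb R^M\to\mathbb R\cup\{+\infty\}$ convex and lower semicontinuous with bounded domain, such that $\|\nabla g_i(y)-\nabla g_i(v)\|\le P_i\|y-v\|$ for $y,v\in\mathrm{dom}(h_i)$, $P_i>0$. For $x=(x_i)\in\mathbb R^{NM}$ put $h(x)=\sum_i h_i(x_i)$, $f(x)=\sum_i (g_i(x_i)+h_i(x_i))$, $\mathrm{dom}(h)=\prod_i\mathrm{dom}(h_i)$. Let $A_1,A_2$ be the matrices with $(A_1x)_{ij}=x_i$, $(A_2x)_{ij}=x_j$ for $(i,j)\in\mathcal A$, let $A=[A_1;A_2]$, $B=[-I;-I]$, $M_+=A_1^T+A_2^T$, and let $(x^*,z^*)$ be an optimal solution of $\min f(x)$ subject to $Ax+Bz=0$. Given $\rho_{ij}>0$ $((i,j)\in\mathcal A)$ and $\omega_i\ge0$, let $\Xi=\mathrm{diag}(\rho_{ij})$, $\Gamma=\mathrm{blkdg}[\Xi\otimes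 I_M,\Xi\otimes I_M]$, $\Omega=\mathrm{diag}(\omega_i)\otimes I_M$, $\widetilde P=\mathrm{diag}(P_i)\otimes I_M$, and $\|v\|_Q^2=v^TQv$. **Stochastic gradients.** The samples $\xi^{1},\xi^2,\dots$, $\xi^{t}=(\xi_i^{t})_i$, are independent over $t$ (not necessarily over $i$), each $\widetilde g_i$ is measurable, $\mathbb E[\widetilde g_i(y,\xi_i^t)]=\nabla g_i(y)$ for $y\in\mathrm{dom}(h_i)$, and the stacked vectors $\widetilde G(x,\xi)=(\widetilde g_i(x_i,\xi_i))_i$, $G(x)=(\nabla g_i(x_i))_i$ satisfy $\mathbb E\|\widetilde G(x,\xi^t)-G(x)\|^2\le\sigma^2$ for all $x\in\mathrm{dom}(h)$ and $t\ge 1$. **Accelerated DySPGC.** Put $\nu^r=\theta^r=\frac2{r+1}$ and $\eta^r=\sqrt{r+1}$. Start from deterministic $x^0,x^{0,\rm ag},\lambda^0,\lambda^{0,\rm ag}$ with $B^T\lambda^0=0$ and from $z^0=z^{0,\rm ag}=\frac12M_+^Tx^0$. For $r=0,1,2,\dots$ let $$x^{r+1,\rm md}=(1-\nu^r)x^{r,\rm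 ag}+\nu^rx^r,$$ $$x^{r+1}=\arg\min_x\Big\{\langle\widetilde G(x^{r+1,\rm md},\xi^{r+1}),x-x^r\rangle+h(x)+\tfrac12\|Ax+Bz^r+\Gamma^{-1}\lambda^r\|_\Gamma^2+\tfrac12\|x-x^r\|^2_{\theta^r\Omega+\eta^{r+1}I}\Big\},$$ $$z^{r+1}=\arg\min_z\tfrac12\|Ax^{r+1}+Bz+\Gamma^{-1}\lambda^r\|_\Gamma^2,\qquad \lambda^{r+1}=\lambda^r+\Gamma(Ax^{r+1}+Bz^{r+1}),$$ and $u^{r+1,\rm ag}=(1-\nu^r)u^{r,\rm ag}+\nu^ru^{r+1}$ for $u=x,z,\lambda$. **Theorem.** Assume $4\Omega+M_+(\Xi\otimes I_M)M_+^T\succ4\widetilde P$, and let $\rho>0$. Put $$d_x=\sup_{\hat x,\tilde x\in\mathrm{dom}(h)}\|\hat x-\tilde x\|,\qquad d_z=\sup_{\hat x,\tilde x\in\mathrm{dom}(h)}\Big(\sum_{(i,j)\in\mathcal A}2\rho_{ij}\|\hat x_i-\tilde x_j\|^2\Big)^{1/2},$$ and, for $r\ge1$, $d_\lambda(\rho)=\sup\|\lambda-\tilde\lambda\|_{\Gamma^{-1}}$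 over all $\lambda$ with $\|\lambda\|\le\rho$ and over all values $\tilde\lambda$ of the dual iterates $\lambda^1,\dots,\lambda^r$ (over all outcomes). Then for every $r\ge1$ the point $x^{r+1,\rm ag}$ lies in $\mathrm{dom}(h)$, $d_\lambda(\rho)$ is finite, the random variable below is integrable, and $$\mathbb E\big[f(x^{r+1,\rm ag})-f(x^*)+\rho\|Ax^{r+1,\rm ag}+Bz^{r+1,\rm ag}\|\big]\le\frac1r\Big(d_z^2+d_\lambda(\rho)^2+\frac{2}{r+1}\max_i\omega_i\,d_x^2\Big)+\frac{2\sigma^2}{3}\frac1{\sqrt{r+1}}+\frac{\sqrt{r+1}}{r}d_x^2 .$$ -/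

import Mathlib

open MeasureTheory ProbabilityTheory
open scoped Matrix Kronecker

noncomputable section

namespace DySPGC

/-! ### Vectors and matrices

`V` is the set of agents, `G` the communication graph on `V`.  The directed arcs `e_ij` of the
companion symmetric digraph are the darts of `G` (so there are `2 E` of them): the arc `e_ij` is
the dart `a` with `a.fst = i` and `a.snd = j`.  All vectors carry the Euclidean norm. -/

/-- `ℝ^M`. -/
abbrev Loc (M : ℕ) : Type := EuclideanSpace ℝ (Fin M)

/-- `ℝ^{NM}`, the space of the stacked variable `x = (x_i)`. -/
abbrev XVec (V : Type*) (M : ℕ) : Type _ := EuclideanSpace ℝ (V × Fin M)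

/-- `ℝ^{2EM}`, the space of the link variable `z = (z_ij)`. -/
abbrev ZVec {V : Type*} (G : SimpleGraph V) (M : ℕ) : Type _ := EuclideanSpace ℝ (G.Dart × Fin M)

/-- `ℝ^{4EM}`, the space of the dual variable. -/
abbrev LVec {V : Type*} (G : SimpleGraph V) (M : ℕ) : Type _ :=
  EuclideanSpace ℝ ((G.Dart × Fin M) ⊕ (G.Dart × Fin M))

/-- The `i`-th block `x_i ∈ ℝ^M` of a stacked vector. -/
def blk {V : Type*} {M : ℕ} (x : XVec V M) (i : V) : Loc M :=
  WithLp.toLp 2 fun m => x (i, m)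

/-- The stacked vector with the given blocks. -/
def stack {V : Type*} {M : ℕ} (y : V → Loc M) : XVec V M :=
  WithLp.toLp 2 fun p => y p.1 p.2

/-- Matrix-vector product on Euclidean spaces. -/
def app {m n : Type*} [Fintype n] (Q : Matrix m n ℝ) (v : EuclideanSpace ℝ n) :
    EuclideanSpace ℝ m :=
  WithLp.toLp 2 (Q *ᵥ v.ofLp)

/-- The weighted square `‖v‖_Q^2 = vᵀ Q v`. -/
def wsq {n : Type*} [Fintype n] (Q : Matrix n n ℝ) (v : EuclideanSpace ℝ n) : ℝ :=
  v.ofLp ⬝ᵥ (Q *ᵥ v.ofLp)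

section Matrices

variable {V : Type*} [DecidableEq V] (G : SimpleGraph V) (M : ℕ)

/-- `A₁`: the block at (arc `e_ij`, node `i`) is `I_M`, all others vanish. -/
def matA₁ : Matrix (G.Dart × Fin M) (V × Fin M) ℝ :=
  (Matrix.of fun (a : G.Dart) (i : V) => if a.fst = i then (1 : ℝ) else 0) ⊗ₖ
    (1 : Matrix (Fin M) (Fin M) ℝ)

/-- `A₂`: the block at (arc `e_ij`, node `j`) is `I_M`, all others vanish. -/
def matA₂ : Matrix (G.Dart × Fin M) (V × Fin M) ℝ :=
  (Matrix.of fun (a : G.Dart) (j : V) => if a.snd = j then (1 : ℝ) else 0) ⊗ₖ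
    (1 : Matrix (Fin M) (Fin M) ℝ)

/-- `A = [A₁; A₂]`. -/
def matA : Matrix ((G.Dart × Fin M) ⊕ (G.Dart × Fin M)) (V × Fin M) ℝ :=
  Matrix.fromRows (matA₁ G M) (matA₂ G M)

/-- `B = [-I; -I]`. -/
def matB : Matrix ((G.Dart × Fin M) ⊕ (G.Dart × Fin M)) (G.Dart × Fin M) ℝ :=
  Matrix.fromRows (-1) (-1)

/-- `M₊ = A₁ᵀ + A₂ᵀ`. -/
def matMplus : Matrix (V × Fin M) (G.Dart × Fin M) ℝ :=
  (matA₁ G M)ᵀ + (matA₂ G M)ᵀ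

variable {G}

/-- The link penalty matrix `Ξ ⊗ I_M`, `Ξ = diag(ρ_ij)`. -/
def matXi (pen : G.Dart → ℝ) : Matrix (G.Dart × Fin M) (G.Dart × Fin M) ℝ :=
  Matrix.diagonal pen ⊗ₖ (1 : Matrix (Fin M) (Fin M) ℝ)

/-- `Γ = blkdg[Ξ ⊗ I_M, Ξ ⊗ I_M]`. -/
def matGam (pen : G.Dart → ℝ) :
    Matrix ((G.Dart × Fin M) ⊕ (G.Dart × Fin M)) ((G.Dart × Fin M) ⊕ (G.Dart × Fin M)) ℝ :=
  Matrix.fromBlocks (matXi M pen) 0 0 (matXi M pen)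

/-- `diag(d_1, …, d_N) ⊗ I_M`; for `d = ω` this is `Ω`, for `d = P` it is `P̃`. -/
def blkDiag (d : V → ℝ) : Matrix (V × Fin M) (V × Fin M) ℝ :=
  Matrix.diagonal d ⊗ₖ (1 : Matrix (Fin M) (Fin M) ℝ)

end Matrices

/-! ### The optimization problem

The extended-valued function `h_i` is represented by its effective domain `D i = dom(h_i)` and its
(real) values `h i` there; it is `+∞` outside `D i`. -/

/-- The domain of the stacked function `h(x) = ∑ i, h_i(x_i)`. -/
def domH {V : Type*} {M : ℕ} (D : V → Set (Loc M)) : Set (XVec V M) :=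
  {x | ∀ i, blk x i ∈ D i}

/-- The stacked objective `f(x) = ∑ i, (g_i(x_i) + h_i(x_i))`, for `x ∈ dom(h)`. -/
def obj {V : Type*} [Fintype V] {M : ℕ} (g h : V → Loc M → ℝ) (x : XVec V M) : ℝ :=
  ∑ i, (g i (blk x i) + h i (blk x i))

/-- The standing assumptions on the problem data: `g_i` is convex and differentiable on `ℝ^M`,
with gradient Lipschitz on `dom(h_i)` with constant `P_i > 0`; `h_i` is convex and lower
semicontinuous (as an extended-valued function, that is, its epigraph is closed), and has a
bounded domain. -/
structure IsData {V : Type*} {M : ℕ} (D : V → Set (Loc M)) (g h : V → Loc M → ℝ) (P : V → ℝ) :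
    Prop where
  g_convex : ∀ i, ConvexOn ℝ Set.univ (g i)
  g_diff : ∀ i, Differentiable ℝ (g i)
  P_pos : ∀ i, 0 < P i
  g_lip : ∀ i, ∀ y ∈ D i, ∀ v ∈ D i, ‖gradient (g i) y - gradient (g i) v‖ ≤ P i * ‖y - v‖
  h_convex : ∀ i, ConvexOn ℝ (D i) (h i)
  h_lsc : ∀ i, IsClosed {p : Loc M × ℝ | p.1 ∈ D i ∧ h i p.1 ≤ p.2}
  bounded : ∀ i, Bornology.IsBounded (D i)

/-- `(x*, z*)` is an optimal solution of `min f(x)` subject to `A x + B z = 0`. -/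
structure IsOptimal {V : Type*} [Fintype V] [DecidableEq V] (G : SimpleGraph V)
    [DecidableRel G.Adj] {M : ℕ} (D : V → Set (Loc M)) (g h : V → Loc M → ℝ)
    (xs : XVec V M) (zs : ZVec G M) : Prop where
  mem_dom : xs ∈ domH D
  feasible : app (matA G M) xs + app (matB G M) zs = 0
  le : ∀ (x : XVec V M) (z : ZVec G M), x ∈ domH D →
    app (matA G M) x + app (matB G M) z = 0 → obj g h xs ≤ obj g h x

/-! ### Stochastic gradients -/

/-- The stacked gradient `G(x) = [∇g_1(x_1); …; ∇g_N(x_N)]`. -/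
def trueGrad {V : Type*} {M : ℕ} (g : V → Loc M → ℝ) (x : XVec V M) : XVec V M :=
  stack fun i => gradient (g i) (blk x i)

/-- The stacked estimate `G̃(x, ξ) = [g̃_1(x_1, ξ_1); …; g̃_N(x_N, ξ_N)]`. -/
def stochGrad {V : Type*} {M : ℕ} {S : V → Type*} (gt : ∀ i, Loc M → S i → Loc M)
    (x : XVec V M) (s : ∀ i, S i) : XVec V M :=
  stack fun i => gt i (blk x i) (s i)

/-- The stochastic gradient model.  `ξ t i` is the sample of agent `i` used at iteration `t ≥ 1`;
samples are independent over time (but arbitrarily dependent across agents).  The estimates are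
unbiased, and the stacked estimate has mean square error at most `σ²`. -/
structure IsOracle {V : Type*} [Fintype V] {M : ℕ} {S : V → Type*} [∀ i, MeasurableSpace (S i)]
    {Om : Type*} [MeasurableSpace Om] (μ : Measure Om)
    (D : V → Set (Loc M)) (g : V → Loc M → ℝ)
    (gt : ∀ i, Loc M → S i → Loc M) (ξ : ℕ → ∀ i, Om → S i) (σ : ℝ) : Prop where
  gt_meas : ∀ i, Measurable (Function.uncurry (gt i))
  ξ_meas : ∀ t i, Measurable (ξ (t + 1) i)
  indep : iIndepFun (fun (t : ℕ) (w : Om) (i : V) => ξ (t + 1) i w) μ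
  integrable : ∀ t i, ∀ y ∈ D i, Integrable (fun w => gt i y (ξ (t + 1) i w)) μ
  unbiased : ∀ t i, ∀ y ∈ D i, ∫ w, gt i y (ξ (t + 1) i w) ∂μ = gradient (g i) y
  sq_integrable : ∀ t, ∀ x ∈ domH D,
    Integrable (fun w => ‖stochGrad gt x (fun i => ξ (t + 1) i w) - trueGrad g x‖ ^ 2) μ
  variance_le : ∀ t, ∀ x ∈ domH D,
    ∫ w, ‖stochGrad gt x (fun i => ξ (t + 1) i w) - trueGrad g x‖ ^ 2 ∂μ ≤ σ ^ 2

/-! ### The accelerated algorithm -/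

/-- All the (random) sequences of the accelerated algorithm. -/
structure Iterates {V : Type*} (G : SimpleGraph V) (M : ℕ) (Om : Type*) where
  /-- `x^r` -/
  x : ℕ → Om → XVec V M
  /-- `x^{r,md}` -/
  xmd : ℕ → Om → XVec V M
  /-- `x^{r,ag}` -/
  xag : ℕ → Om → XVec V M
  /-- `z^r` -/
  z : ℕ → Om → ZVec G M
  /-- `z^{r,ag}` -/
  zag : ℕ → Om → ZVec G M
  /-- `λ^r` -/
  lam : ℕ → Om → LVec G M
  /-- `λ^{r,ag}` -/
  lamag : ℕ → Om → LVec G M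

section Algorithm

variable {V : Type*} [Fintype V] [DecidableEq V] {G : SimpleGraph V} [DecidableRel G.Adj] {M : ℕ}

/-- The objective of the `x`-update, for `x ∈ dom(h)`: here `q` is the stochastic gradient,
`xr, zr, lr` are the current iterates and `th, et` the parameters `θ^r, η^{r+1}`. -/
def xObj (h : V → Loc M → ℝ) (om : V → ℝ) (pen : G.Dart → ℝ) (th et : ℝ)
    (q xr : XVec V M) (zr : ZVec G M) (lr : LVec G M) (x : XVec V M) : ℝ :=
  inner ℝ q (x - xr) + ∑ i, h i (blk x i)
    + 1 / 2 * wsq (matGam M pen)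
        (app (matA G M) x + app (matB G M) zr + app (matGam M pen)⁻¹ lr)
    + 1 / 2 * wsq (th • blkDiag M om + et • (1 : Matrix (V × Fin M) (V × Fin M) ℝ)) (x - xr)

/-- The objective of the `z`-update. -/
def zObj (pen : G.Dart → ℝ) (x : XVec V M) (lr : LVec G M) (z : ZVec G M) : ℝ :=
  1 / 2 * wsq (matGam M pen)
    (app (matA G M) x + app (matB G M) z + app (matGam M pen)⁻¹ lr)

/-- `I` is a run of the accelerated DySPGC algorithm on the static graph `G`, with parameter
sequences `nu, theta, eta`, penalties `pen` and proximal weights `om`, started at the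
(deterministic) points `x0, xag0, lam0, lamag0`. -/
structure IsRun {S : V → Type*} {Om : Type*} (D : V → Set (Loc M)) (h : V → Loc M → ℝ)
    (gt : ∀ i, Loc M → S i → Loc M) (ξ : ℕ → ∀ i, Om → S i)
    (om : V → ℝ) (pen : G.Dart → ℝ) (nu theta eta : ℕ → ℝ)
    (x0 xag0 : XVec V M) (lam0 lamag0 : LVec G M) (I : Iterates G M Om) : Prop where
  init_dual : app (matB G M)ᵀ lam0 = 0
  init_x : ∀ w, I.x 0 w = x0
  init_xag : ∀ w, I.xag 0 w = xag0
  init_z : ∀ w, I.z 0 w = (1 / 2 : ℝ) • app (matMplus G M)ᵀ x0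
  init_zag : ∀ w, I.zag 0 w = (1 / 2 : ℝ) • app (matMplus G M)ᵀ x0
  init_lam : ∀ w, I.lam 0 w = lam0
  init_lamag : ∀ w, I.lamag 0 w = lamag0
  step_xmd : ∀ r w, I.xmd (r + 1) w = (1 - nu r) • I.xag r w + nu r • I.x r w
  step_x_mem : ∀ r w, I.x (r + 1) w ∈ domH D
  step_x : ∀ r w, IsMinOn
    (xObj h om pen (theta r) (eta (r + 1))
      (stochGrad gt (I.xmd (r + 1) w) (fun i => ξ (r + 1) i w))
      (I.x r w) (I.z r w) (I.lam r w))
    (domH D) (I.x (r + 1) w)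
  step_xag : ∀ r w, I.xag (r + 1) w = (1 - nu r) • I.xag r w + nu r • I.x (r + 1) w
  step_z : ∀ r w, IsMinOn (zObj pen (I.x (r + 1) w) (I.lam r w)) Set.univ (I.z (r + 1) w)
  step_zag : ∀ r w, I.zag (r + 1) w = (1 - nu r) • I.zag r w + nu r • I.z (r + 1) w
  step_lam : ∀ r w, I.lam (r + 1) w = I.lam r w +
    app (matGam M pen) (app (matA G M) (I.x (r + 1) w) + app (matB G M) (I.z (r + 1) w))
  step_lamag : ∀ r w, I.lamag (r + 1) w = (1 - nu r) • I.lamag r w + nu r • I.lam (r + 1) w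

/-! ### The constants of the rate -/

/-- `d_x`, the diameter of `dom(h)`. -/
def dX (D : V → Set (Loc M)) : ℝ :=
  sSup {s | ∃ x ∈ domH D, ∃ y ∈ domH D, s = ‖x - y‖}

/-- `d_z`, the supremum over `x, y ∈ dom(h)` of `(∑_{e_ij} 2 ρ_ij ‖x_i - y_j‖²)^{1/2}`. -/
def dZ (D : V → Set (Loc M)) (pen : G.Dart → ℝ) : ℝ :=
  sSup {s | ∃ x ∈ domH D, ∃ y ∈ domH D,
    s = √(∑ a : G.Dart, 2 * pen a * ‖blk x a.fst - blk y a.snd‖ ^ 2)}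

/-- The distances `‖λ - λ'‖_{Γ⁻¹}` with `‖λ‖ ≤ ρ` and `λ'` in a set `L` of dual vectors. -/
def dualDist (pen : G.Dart → ℝ) (ρ : ℝ) (L : Set (LVec G M)) : Set ℝ :=
  {s | ∃ l : LVec G M, ‖l‖ ≤ ρ ∧ ∃ l' ∈ L, s = √(wsq (matGam M pen)⁻¹ (l - l'))}

/-- `d_λ(ρ)`, the supremum of these distances. -/
def dLam (pen : G.Dart → ℝ) (ρ : ℝ) (L : Set (LVec G M)) : ℝ :=
  sSup (dualDist pen ρ L)

/-- The dual iterates `λ^1, …, λ^r`, over all outcomes. -/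
def dualIterates {Om : Type*} (I : Iterates G M Om) (r : ℕ) : Set (LVec G M) :=
  {l | ∃ t, 1 ≤ t ∧ t ≤ r ∧ ∃ w, l = I.lam t w}

/-- The gap `f(x^{r,ag}) - f(x*) + ρ ‖A x^{r,ag} + B z^{r,ag}‖`. -/
def gap {Om : Type*} (g h : V → Loc M → ℝ) (xs : XVec V M) (ρ : ℝ) (I : Iterates G M Om)
    (r : ℕ) (w : Om) : ℝ :=
  obj g h (I.xag r w) - obj g h xs
    + ρ * ‖app (matA G M) (I.xag r w) + app (matB G M) (I.zag r w)‖

end Algorithm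

end DySPGC

end

open DySPGC

set_option linter.unusedSectionVars false

namespace DySPGC

/-! ### Coordinates -/

section Coordinates

variable {V : Type*} [Fintype V] [DecidableEq V] {G : SimpleGraph V} [DecidableRel G.Adj] {M : ℕ}

/-! Fix an outcome and a dual vector `L`, and let `F k` be the objective gap at `x^{k,ag}` plus the
pairing of `L` with the constraint residual there. Each iteration gives `F (r+1) ≤ (1 - ν) F r + ν X
r` (`gap_step`), where `X r` collects differences of squared distances to the solution and to `L`,
plus a gradient-noise term.

Two inequalities produce this recursion. The `x`-update minimizes a convex function plus quadratics,
hence grows quadratically around its minimizer; combined with the dual update this is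
`primal_dual_step`. Convexity and the descent lemma for the smooth part give `obj_step`: since
`x^{ag}` and `x^{md}` differ by `ν` times the move of `x`, the curvature error carries `ν²`, and the
matrix condition lets the proximal and link quadratics absorb it.

With `ν = 2/(r+1)`, multiplying by the products of consecutive integers telescopes the recursion,
and `ν = 1` at `r = 1` erases the initial data. Abel summation bounds the distance differences by
`d_x`, `d_z`, `d_λ`. As the estimate holds for every `L`, one may take `L` of norm `ρ` along the
final residual of that outcome, which turns the pairing into `ρ` times its norm (`IsRun.gap_le`).

Expectation enters last. The noise is a squared gradient error over `2η` minus the pairing of the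
error with `x^r - x*`. The points `x^{r+1,md}` and `x^r` depend on past samples only, so Fubini
bounds the square by the variance and kills the pairing (`IsRun.integral_noise_le`). The necessary
measurability holds because strong convexity makes the minimizer a Lipschitz function of the linear
coefficient of its objective (`exists_continuous_argmin`). -/

lemma app_add {m n : Type*} [Fintype n] (Q : Matrix m n ℝ) (v w : EuclideanSpace ℝ n) :
    app Q (v + w) = app Q v + app Q w := by
  ext i; simp [app, Matrix.mulVec_add]

lemma app_smul {m n : Type*} [Fintype n] (Q : Matrix m n ℝ) (c : ℝ) (v : EuclideanSpace ℝ n) :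
    app Q (c • v) = c • app Q v := by
  ext i; simp [app, Matrix.mulVec_smul]

lemma app_sub {m n : Type*} [Fintype n] (Q : Matrix m n ℝ) (v w : EuclideanSpace ℝ n) :
    app Q (v - w) = app Q v - app Q w := by
  ext i; simp [app, Matrix.mulVec_sub]

lemma continuous_app {m n : Type*} [Fintype m] [Fintype n] (Q : Matrix m n ℝ) :
    Continuous (app Q) := by
  let L : EuclideanSpace ℝ n →ₗ[ℝ] EuclideanSpace ℝ m :=
    { toFun := app Q, map_add' := app_add Q, map_smul' := app_smul Q }
  exact L.continuous_of_finiteDimensional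

lemma exists_norm_app_le {m n : Type*} [Fintype m] [Fintype n] (Q : Matrix m n ℝ) :
    ∃ C, 0 ≤ C ∧ ∀ v, ‖app Q v‖ ≤ C * ‖v‖ := by
  let L : EuclideanSpace ℝ n →ₗ[ℝ] EuclideanSpace ℝ m :=
    { toFun := app Q, map_add' := app_add Q, map_smul' := app_smul Q }
  exact ⟨‖L.toContinuousLinearMap‖, norm_nonneg _, fun v => L.toContinuousLinearMap.le_opNorm v⟩

lemma inner_eq_dotProduct {n : Type*} [Fintype n] (v w : EuclideanSpace ℝ n) :
    inner ℝ v w = v.ofLp ⬝ᵥ w.ofLp := by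
  rw [EuclideanSpace.inner_eq_star_dotProduct, star_trivial, dotProduct_comm]

lemma inner_eq_sum {n : Type*} [Fintype n] (v w : EuclideanSpace ℝ n) :
    inner ℝ v w = ∑ i, v i * w i := by
  rw [inner_eq_dotProduct]; rfl

lemma wsq_eq_inner {n : Type*} [Fintype n] (Q : Matrix n n ℝ) (v : EuclideanSpace ℝ n) :
    wsq Q v = inner ℝ v (app Q v) := by
  rw [inner_eq_dotProduct]; rfl

lemma inner_app {m n : Type*} [Fintype m] [Fintype n] (Q : Matrix m n ℝ)
    (v : EuclideanSpace ℝ n) (w : EuclideanSpace ℝ m) :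
    inner ℝ (app Q v) w = inner ℝ v (app Qᵀ w) := by
  rw [inner_eq_dotProduct, inner_eq_dotProduct]
  simp only [app]
  rw [dotProduct_comm, Matrix.dotProduct_mulVec, Matrix.mulVec_transpose, dotProduct_comm]

lemma wsq_add {n : Type*} [Fintype n] {Q : Matrix n n ℝ} (hQ : Qᵀ = Q)
    (v w : EuclideanSpace ℝ n) :
    wsq Q (v + w) = wsq Q v + 2 * inner ℝ v (app Q w) + wsq Q w := by
  simp only [wsq_eq_inner, app_add, inner_add_left, inner_add_right]
  have : inner ℝ w (app Q v) = inner ℝ v (app Q w) := by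
    rw [real_inner_comm, inner_app, hQ]
  linarith

lemma wsq_smul {n : Type*} [Fintype n] (Q : Matrix n n ℝ) (c : ℝ) (v : EuclideanSpace ℝ n) :
    wsq Q (c • v) = c ^ 2 * wsq Q v := by
  simp only [wsq_eq_inner, app_smul, inner_smul_left, inner_smul_right]
  simp; ring

lemma wsq_diagonal {n : Type*} [Fintype n] [DecidableEq n] (d : n → ℝ) (v : EuclideanSpace ℝ n) :
    wsq (Matrix.diagonal d) v = ∑ i, d i * v i ^ 2 := by
  simp only [wsq, dotProduct, Matrix.mulVec_diagonal]
  exact Finset.sum_congr rfl fun i _ => by ring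

/-- A quadratic form along a segment. -/
lemma wsq_segment {n : Type*} [Fintype n] {Q : Matrix n n ℝ} (hQ : Qᵀ = Q)
    (v w : EuclideanSpace ℝ n) (t : ℝ) :
    wsq Q ((1 - t) • v + t • w)
      = (1 - t) * wsq Q v + t * wsq Q w - t * (1 - t) * wsq Q (w - v) := by
  have h1 : w - v = w + (-1 : ℝ) • v := by simp [sub_eq_add_neg]
  rw [h1, wsq_add hQ, wsq_add hQ, wsq_smul, wsq_smul, wsq_smul, app_smul, app_smul,
    inner_smul_left, inner_smul_right, inner_smul_right]
  have : inner ℝ w (app Q v) = inner ℝ v (app Q w) := by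
    rw [real_inner_comm, inner_app, hQ]
  rw [this]
  simp; ring

lemma exists_wsq_le {n : Type*} [Fintype n] (Q : Matrix n n ℝ) :
    ∃ C, 0 ≤ C ∧ ∀ v, wsq Q v ≤ C * ‖v‖ ^ 2 := by
  obtain ⟨C, hC, h⟩ := exists_norm_app_le Q
  refine ⟨C, hC, fun v => ?_⟩
  rw [wsq_eq_inner]
  nlinarith [real_inner_le_norm v (app Q v), h v, norm_nonneg v]

lemma app_matA₁ (x : XVec V M) (p : G.Dart × Fin M) :
    app (matA₁ G M) x p = x (p.1.fst, p.2) := by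
  simp [app, matA₁, Matrix.mulVec, dotProduct, Fintype.sum_prod_type, Matrix.one_apply]

lemma app_matA₂ (x : XVec V M) (p : G.Dart × Fin M) :
    app (matA₂ G M) x p = x (p.1.snd, p.2) := by
  simp [app, matA₂, Matrix.mulVec, dotProduct, Fintype.sum_prod_type, Matrix.one_apply]

@[simp] lemma app_matA_inl (x : XVec V M) (p : G.Dart × Fin M) :
    app (matA G M) x (Sum.inl p) = x (p.1.fst, p.2) := by
  rw [← app_matA₁]; simp [app, matA]

@[simp] lemma app_matA_inr (x : XVec V M) (p : G.Dart × Fin M) :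
    app (matA G M) x (Sum.inr p) = x (p.1.snd, p.2) := by
  rw [← app_matA₂]; simp [app, matA]

@[simp] lemma app_matB_inl (z : ZVec G M) (p : G.Dart × Fin M) :
    app (matB G M) z (Sum.inl p) = - z p := by
  simp [app, matB, Matrix.neg_mulVec]

@[simp] lemma app_matB_inr (z : ZVec G M) (p : G.Dart × Fin M) :
    app (matB G M) z (Sum.inr p) = - z p := by
  simp [app, matB, Matrix.neg_mulVec]

lemma app_matB_transpose (l : LVec G M) (p : G.Dart × Fin M) :
    app (matB G M)ᵀ l p = - (l (Sum.inl p) + l (Sum.inr p)) := by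
  have h : (matB G M)ᵀ = Matrix.fromCols (-1) (-1) := by
    simp [matB, Matrix.transpose_fromRows]
  simp only [app, h, Matrix.fromCols_mulVec]
  simp [Matrix.neg_mulVec]
  ring

@[simp] lemma app_matMplus_transpose (x : XVec V M) (p : G.Dart × Fin M) :
    app (matMplus G M)ᵀ x p = x (p.1.fst, p.2) + x (p.1.snd, p.2) := by
  rw [← app_matA₁, ← app_matA₂]
  simp [app, matMplus, Matrix.add_mulVec]

lemma blkDiag_eq_diagonal (d : V → ℝ) : blkDiag M d = Matrix.diagonal fun p => d p.1 := by
  rw [blkDiag, ← Matrix.diagonal_one, Matrix.diagonal_kronecker_diagonal]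
  simp

lemma matXi_eq_diagonal (pen : G.Dart → ℝ) : matXi M pen = Matrix.diagonal fun p => pen p.1 := by
  rw [matXi, ← Matrix.diagonal_one, Matrix.diagonal_kronecker_diagonal]
  simp

lemma matGam_eq_diagonal (pen : G.Dart → ℝ) :
    matGam M pen = Matrix.diagonal (Sum.elim (fun p => pen p.1) fun p => pen p.1) := by
  rw [matGam, matXi_eq_diagonal, Matrix.fromBlocks_diagonal]

lemma matGam_transpose (pen : G.Dart → ℝ) : (matGam M pen)ᵀ = matGam M pen := by
  rw [matGam_eq_diagonal, Matrix.diagonal_transpose]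

lemma matGam_inv_eq_diagonal {pen : G.Dart → ℝ} (hpen : ∀ a, 0 < pen a) :
    (matGam M pen)⁻¹
      = Matrix.diagonal (Sum.elim (fun p => (pen p.1)⁻¹) fun p => (pen p.1)⁻¹) := by
  apply Matrix.inv_eq_right_inv
  rw [matGam_eq_diagonal, Matrix.diagonal_mul_diagonal, ← Matrix.diagonal_one]
  congr 1
  funext i
  rcases i with p | p <;> simp [(hpen p.1).ne']

lemma wsq_matGam (pen : G.Dart → ℝ) (v : LVec G M) :
    wsq (matGam M pen) v
      = ∑ p : G.Dart × Fin M, pen p.1 * (v (Sum.inl p) ^ 2 + v (Sum.inr p) ^ 2) := by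
  rw [matGam_eq_diagonal, wsq_diagonal, Fintype.sum_sum_type, ← Finset.sum_add_distrib]
  exact Finset.sum_congr rfl fun i _ => by simp; ring

lemma wsq_matGam_inv {pen : G.Dart → ℝ} (hpen : ∀ a, 0 < pen a) (v : LVec G M) :
    wsq (matGam M pen)⁻¹ v
      = ∑ p : G.Dart × Fin M, (pen p.1)⁻¹ * (v (Sum.inl p) ^ 2 + v (Sum.inr p) ^ 2) := by
  rw [matGam_inv_eq_diagonal hpen, wsq_diagonal, Fintype.sum_sum_type, ← Finset.sum_add_distrib]
  exact Finset.sum_congr rfl fun i _ => by simp; ring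

@[simp] lemma app_matGam_inl (pen : G.Dart → ℝ) (v : LVec G M) (p : G.Dart × Fin M) :
    app (matGam M pen) v (Sum.inl p) = pen p.1 * v (Sum.inl p) := by
  simp [app, matGam_eq_diagonal, Matrix.mulVec_diagonal]

@[simp] lemma app_matGam_inr (pen : G.Dart → ℝ) (v : LVec G M) (p : G.Dart × Fin M) :
    app (matGam M pen) v (Sum.inr p) = pen p.1 * v (Sum.inr p) := by
  simp [app, matGam_eq_diagonal, Matrix.mulVec_diagonal]

lemma app_matGam_inv_inl {pen : G.Dart → ℝ} (hpen : ∀ a, 0 < pen a) (v : LVec G M)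
    (p : G.Dart × Fin M) :
    app (matGam M pen)⁻¹ v (Sum.inl p) = (pen p.1)⁻¹ * v (Sum.inl p) := by
  simp [app, matGam_inv_eq_diagonal hpen, Matrix.mulVec_diagonal]

lemma app_matGam_inv_inr {pen : G.Dart → ℝ} (hpen : ∀ a, 0 < pen a) (v : LVec G M)
    (p : G.Dart × Fin M) :
    app (matGam M pen)⁻¹ v (Sum.inr p) = (pen p.1)⁻¹ * v (Sum.inr p) := by
  simp [app, matGam_inv_eq_diagonal hpen, Matrix.mulVec_diagonal]

lemma proxMatrix_eq_diagonal (th et : ℝ) (om : V → ℝ) :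
    th • blkDiag M om + et • (1 : Matrix (V × Fin M) (V × Fin M) ℝ)
      = Matrix.diagonal fun p => th * om p.1 + et := by
  rw [blkDiag_eq_diagonal, ← Matrix.diagonal_one, ← Matrix.diagonal_smul, ← Matrix.diagonal_smul,
    Matrix.diagonal_add]
  simp

lemma norm_sq_eq_sum {n : Type*} [Fintype n] (v : EuclideanSpace ℝ n) :
    ‖v‖ ^ 2 = ∑ i, v i ^ 2 := by
  rw [EuclideanSpace.norm_sq_eq]; simp

lemma wsq_proxMatrix (th et : ℝ) (om : V → ℝ) (v : XVec V M) :
    wsq (th • blkDiag M om + et • (1 : Matrix (V × Fin M) (V × Fin M) ℝ)) v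
      = th * ∑ p : V × Fin M, om p.1 * v p ^ 2 + et * ‖v‖ ^ 2 := by
  rw [proxMatrix_eq_diagonal, wsq_diagonal, norm_sq_eq_sum, Finset.mul_sum, Finset.mul_sum,
    ← Finset.sum_add_distrib]
  exact Finset.sum_congr rfl fun i _ => by ring

/-- The coordinate form of `4 Ω + M₊ (Ξ ⊗ I) M₊ᵀ ≽ 4 P̃`. -/
lemma lipschitz_weight_le {om P : V → ℝ} {pen : G.Dart → ℝ}
    (hstep : ((4 : ℝ) • blkDiag M om + matMplus G M * matXi M pen * (matMplus G M)ᵀ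
      - (4 : ℝ) • blkDiag M P).PosDef) (d : XVec V M) :
    ∑ p : V × Fin M, P p.1 * d p ^ 2 ≤ ∑ p : V × Fin M, om p.1 * d p ^ 2
      + 1 / 4 * ∑ p : G.Dart × Fin M, pen p.1 * (d (p.1.fst, p.2) + d (p.1.snd, p.2)) ^ 2 := by
  have h := hstep.posSemidef.dotProduct_mulVec_nonneg d.ofLp
  have e1 : ∀ c : V → ℝ, d.ofLp ⬝ᵥ (blkDiag M c *ᵥ d.ofLp) = ∑ p : V × Fin M, c p.1 * d p ^ 2 := by
    intro c
    rw [blkDiag_eq_diagonal]; exact wsq_diagonal _ d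
  have e2 : d.ofLp ⬝ᵥ ((matMplus G M * matXi M pen * (matMplus G M)ᵀ) *ᵥ d.ofLp)
      = ∑ p : G.Dart × Fin M, pen p.1 * (d (p.1.fst, p.2) + d (p.1.snd, p.2)) ^ 2 := by
    rw [← Matrix.mulVec_mulVec, ← Matrix.mulVec_mulVec, Matrix.dotProduct_mulVec,
      ← Matrix.mulVec_transpose, matXi_eq_diagonal]
    have := wsq_diagonal (fun p : G.Dart × Fin M => pen p.1) (app (matMplus G M)ᵀ d)
    simp only [app_matMplus_transpose] at this
    exact this
  rw [star_trivial, Matrix.sub_mulVec, Matrix.add_mulVec, Matrix.smul_mulVec, Matrix.smul_mulVec,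
    dotProduct_sub, dotProduct_add, dotProduct_smul, dotProduct_smul, e1, e1, e2] at h
  simp only [smul_eq_mul] at h
  linarith

lemma blk_smul (c : ℝ) (x : XVec V M) (i : V) : blk (c • x) i = c • blk x i := rfl

lemma continuous_blk (i : V) : Continuous fun x : XVec V M => blk x i := by
  unfold blk; fun_prop

lemma inner_eq_sum_blk (x y : XVec V M) : inner ℝ x y = ∑ i, inner ℝ (blk x i) (blk y i) := by
  simp only [inner_eq_sum, Fintype.sum_prod_type, blk]

lemma norm_sq_eq_sum_blk (x : XVec V M) : ‖x‖ ^ 2 = ∑ i, ‖blk x i‖ ^ 2 := by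
  simp only [norm_sq_eq_sum, Fintype.sum_prod_type, blk]

lemma sum_weight_blk (c : V → ℝ) (x : XVec V M) :
    ∑ p : V × Fin M, c p.1 * x p ^ 2 = ∑ i, c i * ‖blk x i‖ ^ 2 := by
  simp only [norm_sq_eq_sum, Fintype.sum_prod_type, Finset.mul_sum, blk]

end Coordinates

/-! ### Convex analysis -/

/-- Quadratic growth of `H + Q` at a minimizer, for `H` convex and `Q` quadratic. -/
lemma growth_of_isMinOn {E : Type*} [AddCommGroup E] [Module ℝ E] {s : Set E} {H J : E → ℝ}
    (hH : ConvexOn ℝ s H) {x y : E} (hx : x ∈ s) (hy : y ∈ s) {N : ℝ}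
    (hJ : ∀ t : ℝ, J ((1 - t) • x + t • y)
      = H ((1 - t) • x + t • y) + (1 - t) * (J x - H x) + t * (J y - H y) - t * (1 - t) * N)
    (hmin : IsMinOn J s x) : J x + N ≤ J y := by
  -- Comparing the minimizer with a nearby point of the segment to `y` and cancelling `t` costs only
  -- the factor `1 - t` on `N`; letting `t → 0` restores it.
  have key : ∀ t : ℝ, 0 < t → t ≤ 1 → J x + (1 - t) * N ≤ J y := by
    intro t h0 h1
    have h2 : H ((1 - t) • x + t • y) ≤ (1 - t) * H x + t * H y :=
      hH.2 hx hy (by linarith) h0.le (by ring)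
    have h3 : J x ≤ J ((1 - t) • x + t • y) :=
      hmin (hH.1 hx hy (by linarith) h0.le (by ring))
    rw [hJ t] at h3
    have : t * (J x + (1 - t) * N) ≤ t * J y := by nlinarith
    exact le_of_mul_le_mul_left this h0
  have hl : Filter.Tendsto (fun t : ℝ => J x + (1 - t) * N) (nhdsWithin 0 (Set.Ioi 0))
      (nhds (J x + (1 - 0) * N)) := by
    apply Filter.Tendsto.mono_left _ nhdsWithin_le_nhds
    exact (by fun_prop : Continuous fun t : ℝ => J x + (1 - t) * N).tendsto 0
  have := le_of_tendsto hl (by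
    filter_upwards [Ioc_mem_nhdsGT (zero_lt_one' ℝ)] with t ht using key t ht.1 ht.2)
  simpa using this

lemma hasDerivAt_line {E : Type*} [NormedAddCommGroup E] [InnerProductSpace ℝ E] [CompleteSpace E]
    {g : E → ℝ} (hd : Differentiable ℝ g) (x v : E) (t : ℝ) :
    HasDerivAt (fun t : ℝ => g (x + t • v)) (inner ℝ (gradient g (x + t • v)) v) t := by
  have h1 : HasFDerivAt g (InnerProductSpace.toDual ℝ E (gradient g (x + t • v))) (x + t • v) :=
    (hd _).hasGradientAt.hasFDerivAt
  have h2 : HasDerivAt (fun t : ℝ => x + t • v) v t := by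
    simpa using ((hasDerivAt_id t).smul_const v).const_add x
  have h3 := h1.comp_hasDerivAt t h2
  rw [InnerProductSpace.toDual_apply_apply] at h3
  exact h3

lemma gradient_inequality {E : Type*} [NormedAddCommGroup E] [InnerProductSpace ℝ E]
    [CompleteSpace E] {g : E → ℝ} (hg : ConvexOn ℝ Set.univ g) (hd : Differentiable ℝ g)
    (x y : E) : g x + inner ℝ (gradient g x) (y - x) ≤ g y := by
  have hc : ConvexOn ℝ Set.univ fun t : ℝ => g (x + t • (y - x)) := by
    refine ⟨convex_univ, fun s _ t _ a b ha hb hab => ?_⟩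
    have := hg.2 (Set.mem_univ (x + s • (y - x))) (Set.mem_univ (x + t • (y - x))) ha hb hab
    convert this using 2
    have hb' : b = 1 - a := by linarith
    subst hb'
    simp only [smul_eq_mul]
    module
  have := hc.le_slope_of_hasDerivAt (Set.mem_univ 0) (Set.mem_univ 1) one_pos
    (hasDerivAt_line hd x (y - x) 0)
  simp only [slope, zero_smul, add_zero, one_smul, sub_zero, inv_one, vsub_eq_sub,
    add_sub_cancel] at this
  linarith

/-- The descent lemma on a convex set on which the gradient is Lipschitz. -/
lemma descent_lemma {E : Type*} [NormedAddCommGroup E] [InnerProductSpace ℝ E]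
    [CompleteSpace E] {g : E → ℝ} (hd : Differentiable ℝ g) {s : Set E} (hs : Convex ℝ s) {L : ℝ}
    (hL : ∀ y ∈ s, ∀ v ∈ s, ‖gradient g y - gradient g v‖ ≤ L * ‖y - v‖)
    {x y : E} (hx : x ∈ s) (hy : y ∈ s) :
    g y ≤ g x + inner ℝ (gradient g x) (y - x) + L / 2 * ‖y - x‖ ^ 2 := by
  -- The claim is `φ 1 ≤ φ 0`. The Lipschitz bound makes `φ' ≤ 0`, and convexity of `s` keeps the
  -- segment where that bound is available.
  let φ : ℝ → ℝ := fun t =>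
    g (x + t • (y - x)) - t * inner ℝ (gradient g x) (y - x) - t ^ 2 * (L / 2 * ‖y - x‖ ^ 2)
  have hφ : ∀ t, HasDerivAt φ (inner ℝ (gradient g (x + t • (y - x))) (y - x)
      - 1 * inner ℝ (gradient g x) (y - x) - (2 * t) * (L / 2 * ‖y - x‖ ^ 2)) t := by
    intro t
    have h2 : HasDerivAt (fun t : ℝ => t ^ 2) (2 * t) t := by simpa using hasDerivAt_pow 2 t
    exact ((hasDerivAt_line hd x (y - x) t).sub ((hasDerivAt_id t).mul_const _)).sub
      (h2.mul_const _)
  have hanti : AntitoneOn φ (Set.Icc 0 1) := by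
    apply antitoneOn_of_deriv_nonpos (convex_Icc 0 1)
    · exact fun t _ => (hφ t).continuousAt.continuousWithinAt
    · exact fun t _ => (hφ t).differentiableAt.differentiableWithinAt
    · intro t ht
      rw [interior_Icc] at ht
      rw [(hφ t).deriv]
      have hmem : x + t • (y - x) ∈ s := hs.add_smul_sub_mem hx hy ⟨ht.1.le, ht.2.le⟩
      have h1 := hL _ hmem _ hx
      rw [add_sub_cancel_left, norm_smul, Real.norm_of_nonneg ht.1.le] at h1
      have h2 := real_inner_le_norm (gradient g (x + t • (y - x)) - gradient g x) (y - x)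
      rw [inner_sub_left] at h2
      nlinarith [norm_nonneg (y - x)]
  have := hanti (Set.left_mem_Icc.2 zero_le_one) (Set.right_mem_Icc.2 zero_le_one) zero_le_one
  simp only [φ, zero_smul, add_zero, one_smul, add_sub_cancel, zero_mul, sub_zero, one_mul,
    one_pow, ne_eq, OfNat.ofNat_ne_zero, not_false_eq_true, zero_pow] at this
  linarith

/-! ### One iteration, along a fixed outcome -/

section Pathwise

variable {V : Type*} [Fintype V] [DecidableEq V] {G : SimpleGraph V} [DecidableRel G.Adj] {M : ℕ}

/-- The stacked regularizer `h(x) = ∑ i, h_i(x_i)`. -/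
noncomputable def sumBlk (h : V → Loc M → ℝ) (x : XVec V M) : ℝ := ∑ i, h i (blk x i)

lemma obj_eq (g h : V → Loc M → ℝ) (x : XVec V M) : obj g h x = sumBlk g x + sumBlk h x := by
  simp [obj, sumBlk, Finset.sum_add_distrib]

lemma convex_domH {D : V → Set (Loc M)} (hD : ∀ i, Convex ℝ (D i)) : Convex ℝ (domH D) :=
  fun _ hx _ hy _ _ ha hb hab i => hD i (hx i) (hy i) ha hb hab

lemma convexOn_sumBlk {D : V → Set (Loc M)} {h : V → Loc M → ℝ}
    (hh : ∀ i, ConvexOn ℝ (D i) (h i)) : ConvexOn ℝ (domH D) (sumBlk h) := by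
  refine ⟨convex_domH fun i => (hh i).1, fun x hx y hy a b ha hb hab => ?_⟩
  simp only [sumBlk, smul_eq_mul, Finset.mul_sum, ← Finset.sum_add_distrib]
  exact Finset.sum_le_sum fun i _ => (hh i).2 (hx i) (hy i) ha hb hab

/-- Apart from `sumBlk h`, the objective is affine plus two quadratic forms. Along a segment these
obey an exact identity, whose defect is the sum of the forms at `y - x`. -/
lemma xObj_growth {D : V → Set (Loc M)} {h : V → Loc M → ℝ} (hh : ∀ i, ConvexOn ℝ (D i) (h i))
    {om : V → ℝ} {pen : G.Dart → ℝ} {th et : ℝ} {q xr : XVec V M} {zr : ZVec G M}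
    {lr : LVec G M} {x y : XVec V M} (hx : x ∈ domH D) (hy : y ∈ domH D)
    (hmin : IsMinOn (xObj h om pen th et q xr zr lr) (domH D) x) :
    xObj h om pen th et q xr zr lr x + (1 / 2 * wsq (matGam M pen) (app (matA G M) (y - x))
      + 1 / 2 * wsq (th • blkDiag M om + et • (1 : Matrix (V × Fin M) (V × Fin M) ℝ)) (y - x))
      ≤ xObj h om pen th et q xr zr lr y := by
  refine growth_of_isMinOn (convexOn_sumBlk hh) hx hy (fun t => ?_) hmin
  have hW : (th • blkDiag M om + et • (1 : Matrix (V × Fin M) (V × Fin M) ℝ))ᵀ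
      = th • blkDiag M om + et • (1 : Matrix (V × Fin M) (V × Fin M) ℝ) := by
    rw [proxMatrix_eq_diagonal, Matrix.diagonal_transpose]
  set s := app (matB G M) zr + app (matGam M pen)⁻¹ lr with hs
  have e1 : ∀ y : XVec V M, app (matA G M) y + app (matB G M) zr + app (matGam M pen)⁻¹ lr
      = app (matA G M) y + s := fun y => by rw [hs, add_assoc]
  have e2 : app (matA G M) ((1 - t) • x + t • y) + s
      = (1 - t) • (app (matA G M) x + s) + t • (app (matA G M) y + s) := by
    rw [app_add, app_smul, app_smul]; module
  have e3 : (1 - t) • x + t • y - xr = (1 - t) • (x - xr) + t • (y - xr) := by module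
  have e4 : app (matA G M) y + s - (app (matA G M) x + s) = app (matA G M) (y - x) := by
    rw [app_sub]; abel
  have e5 : y - xr - (x - xr) = y - x := by abel
  simp only [xObj, e1]
  rw [e2, e3, wsq_segment (matGam_transpose pen), wsq_segment hW, e4, e5, inner_add_right,
    inner_smul_right, inner_smul_right]
  simp only [sumBlk]
  ring

/-- When the two halves of the dual vector cancel, they drop out of the minimization: the objective
exceeds its value at the endpoint average by a positive weighted sum of squares. -/
lemma eq_half_of_isMinOn_zObj {pen : G.Dart → ℝ} (hpen : ∀ a, 0 < pen a) {x : XVec V M}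
    {l : LVec G M} {z : ZVec G M} (hl : ∀ p, l (Sum.inl p) + l (Sum.inr p) = 0)
    (hmin : IsMinOn (zObj pen x l) Set.univ z) :
    z = (1 / 2 : ℝ) • app (matMplus G M)ᵀ x := by
  set z' : ZVec G M := (1 / 2 : ℝ) • app (matMplus G M)ᵀ x with hz'
  have h1 : zObj pen x l z ≤ zObj pen x l z' := hmin (Set.mem_univ z')
  have h2 : zObj pen x l z - zObj pen x l z'
      = ∑ p : G.Dart × Fin M, pen p.1 * (z p - z' p) ^ 2 := by
    simp only [zObj, wsq_matGam, Finset.mul_sum, ← Finset.sum_sub_distrib]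
    refine Finset.sum_congr rfl fun p _ => ?_
    have h3 : l (Sum.inr p) = - l (Sum.inl p) := by linarith [hl p]
    have h4 : z' p = (x (p.1.fst, p.2) + x (p.1.snd, p.2)) / 2 := by
      rw [hz']; simp; ring
    have h5 := (hpen p.1).ne'
    simp only [PiLp.add_apply, app_matA_inl, app_matA_inr, app_matB_inl, app_matB_inr,
      app_matGam_inv_inl hpen, app_matGam_inv_inr hpen, h3, h4]
    field_simp
    ring
  have h3 : ∀ p ∈ Finset.univ, pen p.1 * (z p - z' p) ^ 2 = 0 :=
    (Finset.sum_eq_zero_iff_of_nonneg fun p _ =>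
      mul_nonneg (hpen p.1).le (sq_nonneg _)).1 (le_antisymm (by linarith)
        (Finset.sum_nonneg fun p _ => mul_nonneg (hpen p.1).le (sq_nonneg _)))
  ext p
  have h4 := h3 p (Finset.mem_univ p)
  have h5 := (mul_eq_zero.1 h4).resolve_left (hpen p.1).ne'
  exact sub_eq_zero.1 (pow_eq_zero_iff two_ne_zero |>.1 h5)

lemma feasible_coord {x : XVec V M} {z : ZVec G M}
    (hf : app (matA G M) x + app (matB G M) z = 0) (p : G.Dart × Fin M) :
    x (p.1.fst, p.2) = z p ∧ x (p.1.snd, p.2) = z p := by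
  have h1 := congrArg (fun v : LVec G M => v (Sum.inl p)) hf
  have h2 := congrArg (fun v : LVec G M => v (Sum.inr p)) hf
  simp only [PiLp.add_apply, app_matA_inl, app_matA_inr, app_matB_inl, app_matB_inr,
    PiLp.zero_apply] at h1 h2
  exact ⟨by linarith, by linarith⟩

/-- The primal-dual inequality of one iteration. -/
lemma primal_dual_step {D : V → Set (Loc M)} {h : V → Loc M → ℝ}
    (hh : ∀ i, ConvexOn ℝ (D i) (h i)) {om : V → ℝ} {pen : G.Dart → ℝ} (hpen : ∀ a, 0 < pen a)
    {th et : ℝ} {q x x' xs : XVec V M} {z z' zs : ZVec G M} {l l' : LVec G M} (L : LVec G M)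
    (hx' : x' ∈ domH D) (hxs : xs ∈ domH D)
    (hf : app (matA G M) xs + app (matB G M) zs = 0)
    (hl : ∀ p, l (Sum.inl p) + l (Sum.inr p) = 0)
    (hz : z = (1 / 2 : ℝ) • app (matMplus G M)ᵀ x)
    (hz' : z' = (1 / 2 : ℝ) • app (matMplus G M)ᵀ x')
    (hl' : l' = l + app (matGam M pen) (app (matA G M) x' + app (matB G M) z'))
    (hmin : IsMinOn (xObj h om pen th et q x z l) (domH D) x') :
    inner ℝ q (x' - xs) + sumBlk h x' - sumBlk h xs
        + inner ℝ L (app (matA G M) x' + app (matB G M) z')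
      ≤ 1 / 2 * (th * ∑ p : V × Fin M, om p.1 * (x - xs) p ^ 2 + et * ‖x - xs‖ ^ 2)
        - 1 / 2 * (th * ∑ p : V × Fin M, om p.1 * (x' - xs) p ^ 2 + et * ‖x' - xs‖ ^ 2)
        - 1 / 2 * (th * ∑ p : V × Fin M, om p.1 * (x' - x) p ^ 2 + et * ‖x' - x‖ ^ 2)
        + 1 / 2 * (∑ p : G.Dart × Fin M, 2 * pen p.1 * (z p - zs p) ^ 2
          - ∑ p : G.Dart × Fin M, 2 * pen p.1 * (z' p - zs p) ^ 2)
        - 1 / 4 * (∑ p : G.Dart × Fin M, pen p.1 *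
          ((x' - x) (p.1.fst, p.2) + (x' - x) (p.1.snd, p.2)) ^ 2)
        + 1 / 2 * (wsq (matGam M pen)⁻¹ (L - l) - wsq (matGam M pen)⁻¹ (L - l')) := by
  have hg := xObj_growth hh hx' hxs hmin
  simp only [xObj] at hg
  simp only [wsq_proxMatrix] at hg
  rw [norm_sub_rev xs x, norm_sub_rev xs x'] at hg
  have e1 : ∑ p : V × Fin M, om p.1 * (xs - x) p ^ 2 = ∑ p : V × Fin M, om p.1 * (x - xs) p ^ 2 :=
    Finset.sum_congr rfl fun p _ => by simp only [PiLp.sub_apply]; ring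
  have e2 : ∑ p : V × Fin M, om p.1 * (xs - x') p ^ 2
      = ∑ p : V × Fin M, om p.1 * (x' - xs) p ^ 2 :=
    Finset.sum_congr rfl fun p _ => by simp only [PiLp.sub_apply]; ring
  rw [e1, e2] at hg
  have e3 : (inner ℝ q (x' - xs) : ℝ) = inner ℝ q (x' - x) - inner ℝ q (xs - x) := by
    rw [← inner_sub_right]; congr 1; abel
  have key : inner ℝ L (app (matA G M) x' + app (matB G M) z')
      + 1 / 2 * wsq (matGam M pen) (app (matA G M) xs + app (matB G M) z + app (matGam M pen)⁻¹ l)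
      - 1 / 2 * wsq (matGam M pen) (app (matA G M) x' + app (matB G M) z + app (matGam M pen)⁻¹ l)
      - 1 / 2 * wsq (matGam M pen) (app (matA G M) (xs - x'))
      ≤ 1 / 2 * (∑ p : G.Dart × Fin M, 2 * pen p.1 * (z p - zs p) ^ 2
          - ∑ p : G.Dart × Fin M, 2 * pen p.1 * (z' p - zs p) ^ 2)
        - 1 / 4 * (∑ p : G.Dart × Fin M, pen p.1 *
          ((x' - x) (p.1.fst, p.2) + (x' - x) (p.1.snd, p.2)) ^ 2)
        + 1 / 2 * (wsq (matGam M pen)⁻¹ (L - l) - wsq (matGam M pen)⁻¹ (L - l')) := by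
    rw [← sub_nonneg, inner_eq_sum, Fintype.sum_sum_type]
    simp only [wsq_matGam, wsq_matGam_inv hpen, Finset.mul_sum, ← Finset.sum_sub_distrib,
      ← Finset.sum_add_distrib]
    refine Finset.sum_nonneg fun p _ => ?_
    obtain ⟨f1, f2⟩ := feasible_coord hf p
    have h3 : l (Sum.inr p) = - l (Sum.inl p) := by linarith [hl p]
    have h4 : z p = (x (p.1.fst, p.2) + x (p.1.snd, p.2)) / 2 := by rw [hz]; simp; ring
    have h5 : z' p = (x' (p.1.fst, p.2) + x' (p.1.snd, p.2)) / 2 := by rw [hz']; simp; ring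
    have h6 := (hpen p.1).ne'
    -- The inequality splits over arcs and coordinates, and this square is exactly the slack of each
    -- summand.
    have h7 : 0 ≤ pen p.1 * ((x' (p.1.fst, p.2) - x' (p.1.snd, p.2)) / 2) ^ 2 :=
      mul_nonneg (hpen p.1).le (sq_nonneg _)
    refine h7.trans_eq ?_
    simp only [hl', PiLp.add_apply, PiLp.sub_apply, app_matA_inl, app_matA_inr, app_matB_inl,
      app_matB_inr, app_matGam_inv_inl hpen, app_matGam_inv_inr hpen, app_matGam_inl,
      app_matGam_inr, h3, h4, h5, f1, f2]
    field_simp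
    ring
  simp only [sumBlk]
  linarith

/-- The objective at the extrapolated point. -/
lemma obj_step {D : V → Set (Loc M)} {g h : V → Loc M → ℝ} {P : V → ℝ}
    (hdata : IsData D g h P) {nu : ℝ} (h0 : 0 ≤ nu) (h1 : nu ≤ 1)
    {x x' xag xag' xmd xs : XVec V M} (hmd : xmd = (1 - nu) • xag + nu • x)
    (hag : xag' = (1 - nu) • xag + nu • x') (hxag : xag ∈ domH D ∨ nu = 1)
    (hxmd : xmd ∈ domH D) (hx' : x' ∈ domH D) (hxag' : xag' ∈ domH D) :
    obj g h xag' ≤ (1 - nu) * obj g h xag + nu * (obj g h xs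
      + inner ℝ (trueGrad g xmd) (x' - xs) + sumBlk h x' - sumBlk h xs)
      + nu ^ 2 / 2 * ∑ p : V × Fin M, P p.1 * (x' - x) p ^ 2 := by
  have hh : sumBlk h xag' ≤ (1 - nu) * sumBlk h xag + nu * sumBlk h x' := by
    -- At `nu = 1` the old aggregate has weight zero, so it may lie outside the domain. The smooth
    -- part needs no such split, its gradient inequality being global.
    rcases hxag with hxag | rfl
    · rw [hag]
      exact (convexOn_sumBlk hdata.h_convex).2 hxag hx' (by linarith) h0 (by ring)
    · simp [hag]
  have hgrad : ∀ y, sumBlk g xmd + inner ℝ (trueGrad g xmd) (y - xmd) ≤ sumBlk g y := by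
    intro y
    rw [inner_eq_sum_blk, sumBlk, sumBlk, ← Finset.sum_add_distrib]
    exact Finset.sum_le_sum fun i _ =>
      gradient_inequality (hdata.g_convex i) (hdata.g_diff i) (blk xmd i) (blk y i)
  have hdesc : sumBlk g xag' ≤ sumBlk g xmd + inner ℝ (trueGrad g xmd) (xag' - xmd)
      + ∑ i, P i / 2 * ‖blk (xag' - xmd) i‖ ^ 2 := by
    rw [inner_eq_sum_blk, sumBlk, sumBlk, ← Finset.sum_add_distrib, ← Finset.sum_add_distrib]
    exact Finset.sum_le_sum fun i _ =>
      descent_lemma (hdata.g_diff i) (hdata.h_convex i).1 (hdata.g_lip i) (hxmd i) (hxag' i)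
  have e1 : xag' - xmd = nu • (x' - x) := by rw [hag, hmd]; module
  have e2 : ∑ i, P i / 2 * ‖blk (xag' - xmd) i‖ ^ 2
      = nu ^ 2 / 2 * ∑ p : V × Fin M, P p.1 * (x' - x) p ^ 2 := by
    rw [sum_weight_blk, e1, Finset.mul_sum]
    refine Finset.sum_congr rfl fun i _ => ?_
    rw [blk_smul, norm_smul, mul_pow, Real.norm_eq_abs, sq_abs]
    ring
  -- The first two pieces feed the gradient inequalities at `xag` and `xs`; the third is the term
  -- matched by `primal_dual_step`.
  have e3 : inner ℝ (trueGrad g xmd) (xag' - xmd)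
      = (1 - nu) * inner ℝ (trueGrad g xmd) (xag - xmd)
        + nu * inner ℝ (trueGrad g xmd) (xs - xmd) + nu * inner ℝ (trueGrad g xmd) (x' - xs) := by
    rw [← real_inner_smul_right, ← real_inner_smul_right, ← real_inner_smul_right,
      ← inner_add_right, ← inner_add_right]
    congr 1
    rw [hag]; module
  rw [obj_eq, obj_eq, obj_eq]
  have h2 := mul_le_mul_of_nonneg_left (hgrad xag) (sub_nonneg.2 h1)
  have h3 := mul_le_mul_of_nonneg_left (hgrad xs) h0
  rw [e2, e3] at hdesc
  nlinarith

/-- The gap recursion of one iteration, for a fixed dual vector `L`. -/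
lemma gap_step {D : V → Set (Loc M)} {g h : V → Loc M → ℝ} {P : V → ℝ}
    (hdata : IsData D g h P) {om : V → ℝ} {pen : G.Dart → ℝ} (hpen : ∀ a, 0 < pen a)
    (hstep : ((4 : ℝ) • blkDiag M om + matMplus G M * matXi M pen * (matMplus G M)ᵀ
      - (4 : ℝ) • blkDiag M P).PosDef)
    {nu et : ℝ} (h0 : 0 < nu) (h1 : nu ≤ 1) (het : 0 < et)
    {q x x' xag xag' xmd xs : XVec V M} {z z' zs zag zag' : ZVec G M} {l l' : LVec G M}
    (L : LVec G M)
    (hmd : xmd = (1 - nu) • xag + nu • x)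
    (hag : xag' = (1 - nu) • xag + nu • x') (hzag : zag' = (1 - nu) • zag + nu • z')
    (hxag : xag ∈ domH D ∨ nu = 1)
    (hxmd : xmd ∈ domH D) (hx' : x' ∈ domH D) (hxag' : xag' ∈ domH D) (hxs : xs ∈ domH D)
    (hf : app (matA G M) xs + app (matB G M) zs = 0)
    (hl : ∀ p, l (Sum.inl p) + l (Sum.inr p) = 0)
    (hz : z = (1 / 2 : ℝ) • app (matMplus G M)ᵀ x)
    (hz' : z' = (1 / 2 : ℝ) • app (matMplus G M)ᵀ x')
    (hl' : l' = l + app (matGam M pen) (app (matA G M) x' + app (matB G M) z'))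
    (hmin : IsMinOn (xObj h om pen nu et q x z l) (domH D) x') :
    obj g h xag' - obj g h xs + inner ℝ L (app (matA G M) xag' + app (matB G M) zag')
      ≤ (1 - nu) * (obj g h xag - obj g h xs
          + inner ℝ L (app (matA G M) xag + app (matB G M) zag))
        + nu * (1 / 2 * nu * (∑ p : V × Fin M, om p.1 * (x - xs) p ^ 2
              - ∑ p : V × Fin M, om p.1 * (x' - xs) p ^ 2)
          + 1 / 2 * et * (‖x - xs‖ ^ 2 - ‖x' - xs‖ ^ 2)
          + 1 / 2 * (∑ p : G.Dart × Fin M, 2 * pen p.1 * (z p - zs p) ^ 2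
            - ∑ p : G.Dart × Fin M, 2 * pen p.1 * (z' p - zs p) ^ 2)
          + 1 / 2 * (wsq (matGam M pen)⁻¹ (L - l) - wsq (matGam M pen)⁻¹ (L - l'))
          + (‖q - trueGrad g xmd‖ ^ 2 / (2 * et)
            - inner ℝ (q - trueGrad g xmd) (x - xs))) := by
  have hA := primal_dual_step hdata.h_convex hpen L hx' hxs hf hl hz hz' hl' hmin
  have hB := obj_step hdata h0.le h1 hmd hag hxag hxmd hx' hxag' (xs := xs)
  have hC := lipschitz_weight_le hstep (x' - x)
  set δ := q - trueGrad g xmd with hδ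
  -- The error is paired with `x - xs`, where `x` predates the fresh sample, and with `x' - x`,
  -- which the `et` part of the proximal term absorbs by Young's inequality (`e2`).
  have e1 : (inner ℝ q (x' - xs) : ℝ)
      = inner ℝ (trueGrad g xmd) (x' - xs) + inner ℝ δ (x - xs) + inner ℝ δ (x' - x) := by
    rw [add_assoc, ← inner_add_right, hδ, sub_add_sub_cancel', ← inner_add_left]
    simp
  have e2 : -(inner ℝ δ (x' - x)) - et / 2 * ‖x' - x‖ ^ 2 ≤ ‖δ‖ ^ 2 / (2 * et) := by
    have h2 := abs_le.1 (abs_real_inner_le_norm δ (x' - x))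
    rw [le_div_iff₀ (by positivity)]
    nlinarith [sq_nonneg (‖δ‖ - et * ‖x' - x‖), h2.1]
  have e3 : inner ℝ L (app (matA G M) xag' + app (matB G M) zag')
      = (1 - nu) * inner ℝ L (app (matA G M) xag + app (matB G M) zag)
        + nu * inner ℝ L (app (matA G M) x' + app (matB G M) z') := by
    rw [hag, hzag]
    simp only [app_add, app_smul, inner_add_right, inner_smul_right]
    ring
  -- The `ν²/2` of `obj_step` becomes `ν/2` once a factor `ν` is taken out, so `θ = ν` matches the
  -- `Ω` part; `ν ≤ 1` leaves a link part of at most `ν/8 ≤ 1/4`.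
  have e4 : nu / 2 * ∑ p : V × Fin M, P p.1 * (x' - x) p ^ 2
      ≤ nu / 2 * (∑ p : V × Fin M, om p.1 * (x' - x) p ^ 2)
        + 1 / 4 * ∑ p : G.Dart × Fin M, pen p.1 *
          ((x' - x) (p.1.fst, p.2) + (x' - x) (p.1.snd, p.2)) ^ 2 := by
    have h2 : 0 ≤ ∑ p : G.Dart × Fin M, pen p.1 *
          ((x' - x) (p.1.fst, p.2) + (x' - x) (p.1.snd, p.2)) ^ 2 :=
      Finset.sum_nonneg fun p _ => mul_nonneg (hpen p.1).le (sq_nonneg _)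
    nlinarith
  rw [e1] at hA
  rw [e3]
  have key : (inner ℝ (trueGrad g xmd) (x' - xs) + sumBlk h x' - sumBlk h xs
      + inner ℝ L (app (matA G M) x' + app (matB G M) z')
      + nu / 2 * ∑ p : V × Fin M, P p.1 * (x' - x) p ^ 2)
      ≤ (1 / 2 * nu * (∑ p : V × Fin M, om p.1 * (x - xs) p ^ 2
              - ∑ p : V × Fin M, om p.1 * (x' - xs) p ^ 2)
          + 1 / 2 * et * (‖x - xs‖ ^ 2 - ‖x' - xs‖ ^ 2)
          + 1 / 2 * (∑ p : G.Dart × Fin M, 2 * pen p.1 * (z p - zs p) ^ 2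
            - ∑ p : G.Dart × Fin M, 2 * pen p.1 * (z' p - zs p) ^ 2)
          + 1 / 2 * (wsq (matGam M pen)⁻¹ (L - l) - wsq (matGam M pen)⁻¹ (L - l'))
          + (‖δ‖ ^ 2 / (2 * et) - inner ℝ δ (x - xs))) := by
    linarith
  have := mul_le_mul_of_nonneg_left key h0.le
  nlinarith

end Pathwise

/-! ### Telescoping -/

/-- Abel summation: the nonnegative increments of `w` multiply values at most `C` and add up to `w
n`. Only `c 0, …, c n` need the bound, since `c (n + 1)` is kept. -/
lemma weighted_telescope {w c : ℕ → ℝ} {C : ℝ} (hw0 : 0 ≤ w 0) (hw : Monotone w) (n : ℕ)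
    (hc : ∀ j ≤ n, c j ≤ C) :
    ∑ j ∈ Finset.range (n + 1), w j * (c j - c (j + 1)) ≤ w n * C - w n * c (n + 1) := by
  induction n with
  | zero => simp; nlinarith [hc 0 le_rfl]
  | succ n ih =>
    rw [Finset.sum_range_succ]
    have h1 := ih fun j hj => hc j (by omega)
    have h2 := hw (Nat.le_succ n)
    have h3 := hc (n + 1) le_rfl
    nlinarith [mul_nonneg (sub_nonneg.2 h2) (sub_nonneg.2 h3)]

/-- The weights satisfy `(n+1)(n+2)(1 - 2/(n+2)) = n(n+1)`. The weight of `F 1` is zero, so the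
starting value disappears. -/
lemma recursion_telescope {F X : ℕ → ℝ}
    (h : ∀ j : ℕ, F (j + 2) ≤ (1 - 2 / ((j : ℝ) + 2)) * F (j + 1) + 2 / ((j : ℝ) + 2) * X j)
    (n : ℕ) :
    (n : ℝ) * (n + 1) * F (n + 1) ≤ ∑ j ∈ Finset.range n, 2 * ((j : ℝ) + 1) * X j := by
  induction n with
  | zero => simp
  | succ n ih =>
    rw [Finset.sum_range_succ]
    have h1 := mul_le_mul_of_nonneg_left (h n) (by positivity : 0 ≤ ((n : ℝ) + 1) * (n + 2))
    have h2 : ((n : ℝ) + 1) * (n + 2) * ((1 - 2 / ((n : ℝ) + 2)) * F (n + 1)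
        + 2 / ((n : ℝ) + 2) * X n)
        = (n : ℝ) * (n + 1) * F (n + 1) + 2 * ((n : ℝ) + 1) * X n := by
      field_simp; ring
    push_cast
    have h3 : ((n : ℝ) + 1) * (n + 1 + 1) * F (n + 1 + 1) = ((n : ℝ) + 1) * (n + 2) * F (n + 2) := by
      ring_nf
    linarith

/-- Enlarging each term to `(n+1)/√(n+2)` makes it at most an increment of the right-hand side,
because `√(n+1) √(n+2) ≤ n + 3/2` by AM-GM. -/
lemma sum_div_sqrt_le (n : ℕ) :
    ∑ j ∈ Finset.range n, ((j : ℝ) + 1) / √((j : ℝ) + 3) ≤ 2 / 3 * n * √((n : ℝ) + 1) := by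
  induction n with
  | zero => simp
  | succ n ih =>
    rw [Finset.sum_range_succ]
    push_cast
    have a1 : 0 < √((n : ℝ) + 1) := Real.sqrt_pos.2 (by positivity)
    have a2 : 0 < √((n : ℝ) + 1 + 1) := Real.sqrt_pos.2 (by positivity)
    have s1 : √((n : ℝ) + 1) ^ 2 = n + 1 := Real.sq_sqrt (by positivity)
    have s2 : √((n : ℝ) + 1 + 1) ^ 2 = n + 1 + 1 := Real.sq_sqrt (by positivity)
    have h1 : ((n : ℝ) + 1) / √((n : ℝ) + 3) ≤ ((n : ℝ) + 1) / √((n : ℝ) + 1 + 1) :=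
      div_le_div_of_nonneg_left (by positivity) a2 (Real.sqrt_le_sqrt (by linarith))
    have h2 : ((n : ℝ) + 1) / √((n : ℝ) + 1 + 1)
        ≤ 2 / 3 * ((n + 1) * √((n : ℝ) + 1 + 1) - n * √((n : ℝ) + 1)) := by
      rw [div_le_iff₀ a2]
      have h3 : √((n : ℝ) + 1) * √((n : ℝ) + 1 + 1) ≤ n + 3 / 2 := by
        nlinarith [sq_nonneg (√((n : ℝ) + 1) - √((n : ℝ) + 1 + 1))]
      have h4 : (0 : ℝ) ≤ n := by positivity
      nlinarith [mul_le_mul_of_nonneg_left h3 h4]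
    linarith

/-! ### The constants `d_x`, `d_z`, `d_λ` -/

section Constants

variable {V : Type*} [Fintype V] [DecidableEq V] {G : SimpleGraph V} [DecidableRel G.Adj] {M : ℕ}

lemma exists_norm_le_of_mem_domH {D : V → Set (Loc M)} (hD : ∀ i, Bornology.IsBounded (D i)) :
    ∃ C, 0 ≤ C ∧ ∀ x ∈ domH D, ‖x‖ ≤ C := by
  choose c hc using fun i => (hD i).exists_norm_le
  refine ⟨√(∑ i, c i ^ 2), Real.sqrt_nonneg _, fun x hx => Real.le_sqrt_of_sq_le ?_⟩
  rw [norm_sq_eq_sum_blk]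
  exact Finset.sum_le_sum fun i _ => pow_le_pow_left₀ (norm_nonneg _) (hc i _ (hx i)) 2

lemma norm_blk_le (x : XVec V M) (i : V) : ‖blk x i‖ ≤ ‖x‖ := by
  refine pow_le_pow_iff_left₀ (norm_nonneg _) (norm_nonneg _) two_ne_zero |>.1 ?_
  rw [norm_sq_eq_sum_blk]
  exact Finset.single_le_sum (f := fun i => ‖blk x i‖ ^ 2) (fun i _ => sq_nonneg _)
    (Finset.mem_univ i)

/-- A real `sSup` bounds its set only if the set is bounded above; the bounded domains supply this
here, and likewise for `dZ`. -/
lemma norm_sub_le_dX {D : V → Set (Loc M)} (hD : ∀ i, Bornology.IsBounded (D i))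
    {x y : XVec V M} (hx : x ∈ domH D) (hy : y ∈ domH D) : ‖x - y‖ ≤ dX D := by
  obtain ⟨C, -, h⟩ := exists_norm_le_of_mem_domH hD
  refine le_csSup ⟨C + C, ?_⟩ ⟨x, hx, y, hy, rfl⟩
  rintro s ⟨x, hx, y, hy, rfl⟩
  exact (norm_sub_le x y).trans (add_le_add (h x hx) (h y hy))

lemma sum_le_dZ_sq {D : V → Set (Loc M)} (hD : ∀ i, Bornology.IsBounded (D i))
    {pen : G.Dart → ℝ} (hpen : ∀ a, 0 < pen a)
    {x y : XVec V M} (hx : x ∈ domH D) (hy : y ∈ domH D) :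
    ∑ a : G.Dart, 2 * pen a * ‖blk x a.fst - blk y a.snd‖ ^ 2 ≤ dZ D pen ^ 2 := by
  obtain ⟨C, hC, h⟩ := exists_norm_le_of_mem_domH hD
  have hle : √(∑ a : G.Dart, 2 * pen a * ‖blk x a.fst - blk y a.snd‖ ^ 2) ≤ dZ D pen := by
    refine le_csSup ⟨√(∑ a : G.Dart, 2 * pen a * (C + C) ^ 2), ?_⟩ ⟨x, hx, y, hy, rfl⟩
    rintro s ⟨x, hx, y, hy, rfl⟩
    refine Real.sqrt_le_sqrt (Finset.sum_le_sum fun a _ => ?_)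
    have h1 := (norm_sub_le (blk x a.fst) (blk y a.snd)).trans
      (add_le_add ((norm_blk_le x _).trans (h x hx)) ((norm_blk_le y _).trans (h y hy)))
    have h2 := hpen a
    gcongr
  have h0 : 0 ≤ ∑ a : G.Dart, 2 * pen a * ‖blk x a.fst - blk y a.snd‖ ^ 2 :=
    Finset.sum_nonneg fun a _ => mul_nonneg (by linarith [hpen a]) (sq_nonneg _)
  calc _ = √(∑ a : G.Dart, 2 * pen a * ‖blk x a.fst - blk y a.snd‖ ^ 2) ^ 2 := (Real.sq_sqrt h0).symm
    _ ≤ _ := pow_le_pow_left₀ (Real.sqrt_nonneg _) hle 2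

/-- Here `z` averages the two endpoints of an arc while `zs` is their common optimal value, so `z -
zs` is the mean of the cross differences `x_i - xs_j` and `x_j - xs_i`. Convexity of the square
finishes. -/
lemma link_dist_le_dZ_sq {D : V → Set (Loc M)} (hD : ∀ i, Bornology.IsBounded (D i))
    {pen : G.Dart → ℝ} (hpen : ∀ a, 0 < pen a) {x xs : XVec V M} {z zs : ZVec G M}
    (hx : x ∈ domH D) (hxs : xs ∈ domH D)
    (hf : app (matA G M) xs + app (matB G M) zs = 0)
    (hz : z = (1 / 2 : ℝ) • app (matMplus G M)ᵀ x) :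
    ∑ p : G.Dart × Fin M, 2 * pen p.1 * (z p - zs p) ^ 2 ≤ dZ D pen ^ 2 := by
  have h1 := sum_le_dZ_sq hD hpen hx hxs
  have h2 := sum_le_dZ_sq hD hpen hxs hx
  have e : ∀ x y : XVec V M, ∑ a : G.Dart, 2 * pen a * ‖blk x a.fst - blk y a.snd‖ ^ 2
      = ∑ p : G.Dart × Fin M, 2 * pen p.1 * (x (p.1.fst, p.2) - y (p.1.snd, p.2)) ^ 2 := by
    intro x y
    simp only [norm_sq_eq_sum, Fintype.sum_prod_type, Finset.mul_sum, blk, PiLp.sub_apply]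
  rw [e] at h1 h2
  have h3 : ∑ p : G.Dart × Fin M, 2 * pen p.1 * (z p - zs p) ^ 2
      ≤ ∑ p : G.Dart × Fin M, (1 / 2 * (2 * pen p.1 * (x (p.1.fst, p.2) - xs (p.1.snd, p.2)) ^ 2)
        + 1 / 2 * (2 * pen p.1 * (xs (p.1.fst, p.2) - x (p.1.snd, p.2)) ^ 2)) := by
    refine Finset.sum_le_sum fun p _ => ?_
    obtain ⟨f1, f2⟩ := feasible_coord hf p
    have h4 : z p = (x (p.1.fst, p.2) + x (p.1.snd, p.2)) / 2 := by rw [hz]; simp; ring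
    rw [f1, f2, h4]
    nlinarith [mul_nonneg (hpen p.1).le (sq_nonneg (x (p.1.fst, p.2) - x (p.1.snd, p.2)))]
  rw [Finset.sum_add_distrib, ← Finset.mul_sum, ← Finset.mul_sum] at h3
  linarith

lemma weighted_sq_le {om : V → ℝ} (x : XVec V M) :
    ∑ p : V × Fin M, om p.1 * x p ^ 2 ≤ (⨆ i, om i) * ‖x‖ ^ 2 := by
  rw [norm_sq_eq_sum, Finset.mul_sum]
  exact Finset.sum_le_sum fun p _ => mul_le_mul_of_nonneg_right
    (le_ciSup (Set.finite_range om).bddAbove p.1) (sq_nonneg _)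

lemma bddAbove_dualDist {pen : G.Dart → ℝ} (ρ : ℝ) {L : Set (LVec G M)}
    {C : ℝ} (hL : ∀ l ∈ L, ‖l‖ ≤ C) : BddAbove (dualDist pen ρ L) := by
  obtain ⟨K, hK, hw⟩ := exists_wsq_le (matGam M pen)⁻¹
  refine ⟨√(K * (ρ + C) ^ 2), ?_⟩
  rintro s ⟨l, hl, l', hl', rfl⟩
  refine Real.sqrt_le_sqrt ((hw _).trans ?_)
  have := (norm_sub_le l l').trans (add_le_add hl (hL l' hl'))
  gcongr

lemma wsq_matGam_inv_nonneg {pen : G.Dart → ℝ} (hpen : ∀ a, 0 < pen a) (v : LVec G M) :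
    0 ≤ wsq (matGam M pen)⁻¹ v := by
  rw [wsq_matGam_inv hpen]
  exact Finset.sum_nonneg fun p _ => mul_nonneg (inv_nonneg.2 (hpen p.1).le) (by positivity)

lemma wsq_le_dLam_sq {pen : G.Dart → ℝ} (hpen : ∀ a, 0 < pen a) {ρ : ℝ} {L : Set (LVec G M)}
    (hb : BddAbove (dualDist pen ρ L)) {l l' : LVec G M} (hl : ‖l‖ ≤ ρ) (hl' : l' ∈ L) :
    wsq (matGam M pen)⁻¹ (l - l') ≤ dLam pen ρ L ^ 2 := by
  have h1 : √(wsq (matGam M pen)⁻¹ (l - l')) ≤ dLam pen ρ L := le_csSup hb ⟨l, hl, l', hl', rfl⟩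
  rw [← Real.sq_sqrt (wsq_matGam_inv_nonneg hpen (l - l'))]
  exact pow_le_pow_left₀ (Real.sqrt_nonneg _) h1 2

end Constants

/-! ### Runs of the algorithm -/

section Runs

variable {V : Type*} [Fintype V] [DecidableEq V] {G : SimpleGraph V} [DecidableRel G.Adj] {M : ℕ}
  {D : V → Set (Loc M)} {g h : V → Loc M → ℝ} {P : V → ℝ}
  {S : V → Type*} {Om : Type*} {gt : ∀ i, Loc M → S i → Loc M} {ξ : ℕ → ∀ i, Om → S i}
  {om : V → ℝ} {pen : G.Dart → ℝ} {nu theta eta : ℕ → ℝ}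
  {x0 xag0 : XVec V M} {lam0 lamag0 : LVec G M} {I : Iterates G M Om}

/-- The two claims propagate together: cancelling dual halves make `z` the endpoint average, which
makes the two residual halves opposite. Both carry the same penalty, so the updated dual halves
cancel again. -/
lemma IsRun.dual_and_link (hpen : ∀ a, 0 < pen a)
    (hrun : IsRun D h gt ξ om pen nu theta eta x0 xag0 lam0 lamag0 I) (r : ℕ) (w : Om) :
    (∀ p, I.lam r w (Sum.inl p) + I.lam r w (Sum.inr p) = 0) ∧
      I.z r w = (1 / 2 : ℝ) • app (matMplus G M)ᵀ (I.x r w) := by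
  induction r with
  | zero =>
    refine ⟨fun p => ?_, by rw [hrun.init_z, hrun.init_x]⟩
    have h1 := app_matB_transpose lam0 p
    rw [hrun.init_dual] at h1
    rw [hrun.init_lam]
    simp only [PiLp.zero_apply] at h1
    linarith
  | succ r ih =>
    have hz := eq_half_of_isMinOn_zObj hpen ih.1 (hrun.step_z r w)
    refine ⟨fun p => ?_, hz⟩
    have h1 := ih.1 p
    rw [hrun.step_lam, hz]
    simp only [PiLp.add_apply, app_matGam_inl, app_matGam_inr, app_matA_inl, app_matA_inr,
      app_matB_inl, app_matB_inr, PiLp.smul_apply, app_matMplus_transpose, smul_eq_mul]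
    linear_combination h1

/-- The primal iterates stay in a bounded set, so each dual step has bounded length. The bound grows
with `r` but is uniform over outcomes. -/
lemma IsRun.exists_norm_lam_le (hD : ∀ i, Bornology.IsBounded (D i)) (hpen : ∀ a, 0 < pen a)
    (hrun : IsRun D h gt ξ om pen nu theta eta x0 xag0 lam0 lamag0 I) (r : ℕ) :
    ∃ C, ∀ t ≤ r, ∀ w, ‖I.lam t w‖ ≤ C := by
  obtain ⟨C, hC, hx⟩ := exists_norm_le_of_mem_domH hD
  obtain ⟨a, ha, hA⟩ := exists_norm_app_le (matA G M)
  obtain ⟨b, hb, hB⟩ := exists_norm_app_le (matB G M)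
  obtain ⟨c, hc, hΓ⟩ := exists_norm_app_le (matGam M pen)
  obtain ⟨m, hm, hM⟩ := exists_norm_app_le (matMplus G M)ᵀ
  induction r with
  | zero => exact ⟨‖lam0‖, fun t ht w => by rw [Nat.le_zero.1 ht, hrun.init_lam]⟩
  | succ r ih =>
    obtain ⟨K, hK⟩ := ih
    have hK0 : 0 ≤ c * (a * C + b * (1 / 2 * (m * C))) := by positivity
    refine ⟨K + c * (a * C + b * (1 / 2 * (m * C))), fun t ht w => ?_⟩
    rcases Nat.le_succ_iff.1 ht with h1 | rfl
    · linarith [hK t h1 w]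
    · have hxx := hx _ (hrun.step_x_mem r w)
      rw [hrun.step_lam]
      refine (norm_add_le _ _).trans (add_le_add (hK r le_rfl w) ((hΓ _).trans ?_))
      refine mul_le_mul_of_nonneg_left ((norm_add_le _ _).trans (add_le_add ((hA _).trans ?_)
        ((hB _).trans ?_))) hc
      · gcongr
      · rw [(hrun.dual_and_link hpen (r + 1) w).2, norm_smul]
        refine mul_le_mul_of_nonneg_left ?_ hb
        rw [Real.norm_of_nonneg (by norm_num)]
        refine mul_le_mul_of_nonneg_left ((hM _).trans ?_) (by norm_num)
        gcongr

lemma IsRun.bddAbove_dualDist (hD : ∀ i, Bornology.IsBounded (D i)) (hpen : ∀ a, 0 < pen a)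
    (hrun : IsRun D h gt ξ om pen nu theta eta x0 xag0 lam0 lamag0 I) (ρ : ℝ) (r : ℕ) :
    BddAbove (dualDist pen ρ (dualIterates I r)) := by
  obtain ⟨C, hC⟩ := hrun.exists_norm_lam_le hD hpen r
  refine DySPGC.bddAbove_dualDist ρ (C := C) ?_
  rintro l ⟨t, -, ht, w, rfl⟩
  exact hC t ht w

end Runs

/-! ### The accelerated parameters -/

section Accelerated

variable {V : Type*} [Fintype V] [DecidableEq V] {G : SimpleGraph V} [DecidableRel G.Adj] {M : ℕ}
  {D : V → Set (Loc M)} {g h : V → Loc M → ℝ} {P : V → ℝ}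
  {S : V → Type*} {Om : Type*} {gt : ∀ i, Loc M → S i → Loc M} {ξ : ℕ → ∀ i, Om → S i}
  {om : V → ℝ} {pen : G.Dart → ℝ} {theta eta : ℕ → ℝ}
  {x0 xag0 : XVec V M} {lam0 lamag0 : LVec G M} {I : Iterates G M Om}

/-- Index `2` is the first safe one: `ν⁰ = 2` extrapolates and may leave the domain, while `ν¹ = 1`
resets the aggregate to `x²`. All later steps are convex combinations. -/
lemma IsRun.xag_mem (hD : ∀ i, Convex ℝ (D i))
    (hrun : IsRun D h gt ξ om pen (fun r : ℕ => 2 / ((r : ℝ) + 1)) theta eta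
      x0 xag0 lam0 lamag0 I) (r : ℕ) (w : Om) : I.xag (r + 2) w ∈ domH D := by
  induction r with
  | zero =>
    rw [hrun.step_xag]
    norm_num
    exact hrun.step_x_mem 1 w
  | succ r ih =>
    rw [hrun.step_xag]
    have : 2 / (((r + 2 : ℕ) : ℝ) + 1) ≤ 1 := by
      rw [div_le_one (by positivity)]; push_cast; linarith
    exact convex_domH hD ih (hrun.step_x_mem _ w) (sub_nonneg.2 this) (by positivity) (by ring)

lemma IsRun.xmd_mem (hD : ∀ i, Convex ℝ (D i))
    (hrun : IsRun D h gt ξ om pen (fun r : ℕ => 2 / ((r : ℝ) + 1)) theta eta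
      x0 xag0 lam0 lamag0 I) (r : ℕ) (w : Om) : I.xmd (r + 2) w ∈ domH D := by
  rw [hrun.step_xmd]
  cases r with
  | zero =>
    norm_num
    exact hrun.step_x_mem 0 w
  | succ r =>
    have : 2 / (((r + 1 + 1 : ℕ) : ℝ) + 1) ≤ 1 := by
      rw [div_le_one (by positivity)]; push_cast; linarith
    exact convex_domH hD (hrun.xag_mem hD r w) (hrun.step_x_mem _ w) (sub_nonneg.2 this)
      (by positivity) (by ring)

/-- The error of the stochastic gradient used in the step from `x^{j+1}` to `x^{j+2}`. -/
noncomputable def gradError (g : V → Loc M → ℝ) (gt : ∀ i, Loc M → S i → Loc M) (ξ : ℕ → ∀ i, Om → S i)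
    (I : Iterates G M Om) (j : ℕ) (w : Om) : XVec V M :=
  stochGrad gt (I.xmd (j + 2) w) (fun i => ξ (j + 2) i w) - trueGrad g (I.xmd (j + 2) w)

/-- The contribution of the stochastic error to the gap. -/
noncomputable def noise (g : V → Loc M → ℝ) (gt : ∀ i, Loc M → S i → Loc M)
    (ξ : ℕ → ∀ i, Om → S i) (I : Iterates G M Om) (xs : XVec V M) (j : ℕ) (w : Om) : ℝ :=
  ‖gradError g gt ξ I j w‖ ^ 2 / (2 * √((j : ℝ) + 3))
    - inner ℝ (gradError g gt ξ I j w) (I.x (j + 1) w - xs)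

/-- The convergence rate along a fixed outcome. -/
lemma IsRun.gap_le (hdata : IsData D g h P) (hom : ∀ i, 0 ≤ om i) (hpen : ∀ a, 0 < pen a)
    (hstep : ((4 : ℝ) • blkDiag M om + matMplus G M * matXi M pen * (matMplus G M)ᵀ
      - (4 : ℝ) • blkDiag M P).PosDef)
    {xs : XVec V M} {zs : ZVec G M} (hopt : IsOptimal G D g h xs zs)
    (hrun : IsRun D h gt ξ om pen
      (fun r : ℕ => 2 / ((r : ℝ) + 1)) (fun r : ℕ => 2 / ((r : ℝ) + 1))
      (fun r : ℕ => √((r : ℝ) + 1)) x0 xag0 lam0 lamag0 I)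
    {ρ : ℝ} (hρ : 0 < ρ) (n : ℕ) (w : Om) :
    ((n : ℝ) + 1) * (n + 2) * gap g h xs ρ I (n + 2) w ≤
      ((n : ℝ) + 1) * (dZ D pen ^ 2 + dLam pen ρ (dualIterates I (n + 1)) ^ 2)
        + 2 * ((n : ℝ) + 1) / (n + 2) * ((⨆ i, om i) * dX D ^ 2)
        + ((n : ℝ) + 1) * √((n : ℝ) + 3) * dX D ^ 2
        + ∑ j ∈ Finset.range (n + 1), 2 * ((j : ℝ) + 1) * noise g gt ξ I xs j w := by
  have hconv := fun i => (hdata.h_convex i).1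
  have hbdd := hrun.bddAbove_dualDist hdata.bounded hpen ρ (n + 1)
  set R := app (matA G M) (I.xag (n + 2) w) + app (matB G M) (I.zag (n + 2) w) with hR
  -- Aligned with the final residual, `L` attains the supremum of the pairing over the ball of
  -- radius `ρ`. It depends on the outcome, which is harmless in a pathwise bound.
  obtain ⟨L, hL, hLR⟩ : ∃ L : LVec G M, ‖L‖ ≤ ρ ∧ inner ℝ L R = ρ * ‖R‖ := by
    rcases eq_or_ne R 0 with h0 | h0
    · exact ⟨0, by simpa using hρ.le, by simp [h0]⟩
    · have h1 : ‖R‖ ≠ 0 := norm_ne_zero_iff.2 h0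
      refine ⟨(ρ / ‖R‖) • R, ?_, ?_⟩
      · rw [norm_smul, Real.norm_of_nonneg (by positivity), div_mul_cancel₀ _ h1]
      · rw [real_inner_smul_left, real_inner_self_eq_norm_sq]
        field_simp
  let c : ℕ → ℝ := fun j => ∑ p : V × Fin M, om p.1 * (I.x (j + 1) w - xs) p ^ 2
  let e : ℕ → ℝ := fun j => ‖I.x (j + 1) w - xs‖ ^ 2
  let a : ℕ → ℝ := fun j => ∑ p : G.Dart × Fin M, 2 * pen p.1 * (I.z (j + 1) w p - zs p) ^ 2
  let b : ℕ → ℝ := fun j => wsq (matGam M pen)⁻¹ (L - I.lam (j + 1) w)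
  let F : ℕ → ℝ := fun k => obj g h (I.xag k w) - obj g h xs
    + inner ℝ L (app (matA G M) (I.xag k w) + app (matB G M) (I.zag k w))
  -- Index `j` stands for iteration `r = j + 1`, hence `ν = 2/(j+2)` and `η^{r+1} = √(j+3)`; the
  -- step `r = 0` is left out.
  have hmain := recursion_telescope (F := F) (X := fun j =>
      1 / 2 * (2 / ((j : ℝ) + 2)) * (c j - c (j + 1))
        + 1 / 2 * √((j : ℝ) + 3) * (e j - e (j + 1))
        + 1 / 2 * (a j - a (j + 1)) + 1 / 2 * (b j - b (j + 1)) + noise g gt ξ I xs j w) (by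
    intro j
    have en : 2 / (((j + 1 : ℕ) : ℝ) + 1) = 2 / ((j : ℝ) + 2) := by push_cast; ring_nf
    have ee : √(((j + 1 + 1 : ℕ) : ℝ) + 1) = √((j : ℝ) + 3) := by push_cast; ring_nf
    have s1 := hrun.step_xmd (j + 1) w
    have s2 := hrun.step_xag (j + 1) w
    have s3 := hrun.step_zag (j + 1) w
    have s4 := hrun.step_x (j + 1) w
    simp only [en, ee] at s1 s2 s3 s4
    have hdisj : I.xag (j + 1) w ∈ domH D ∨ 2 / ((j : ℝ) + 2) = 1 := by
      cases j with
      | zero => right; norm_num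
      | succ j => left; exact hrun.xag_mem hconv j w
    exact gap_step hdata hpen hstep (nu := 2 / ((j : ℝ) + 2)) (et := √((j : ℝ) + 3))
      (by positivity) (by rw [div_le_one (by positivity)]; linarith [(Nat.cast_nonneg j : (0:ℝ) ≤ j)])
      (by positivity) L s1 s2 s3 hdisj
      (hrun.xmd_mem hconv j w) (hrun.step_x_mem (j + 1) w) (hrun.xag_mem hconv j w) hopt.mem_dom
      hopt.feasible (hrun.dual_and_link hpen (j + 1) w).1 (hrun.dual_and_link hpen (j + 1) w).2
      (hrun.dual_and_link hpen (j + 2) w).2 (hrun.step_lam (j + 1) w) s4) (n + 1)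
  have hsplit : ∀ j ∈ Finset.range (n + 1), 2 * ((j : ℝ) + 1) *
      (1 / 2 * (2 / ((j : ℝ) + 2)) * (c j - c (j + 1))
        + 1 / 2 * √((j : ℝ) + 3) * (e j - e (j + 1))
        + 1 / 2 * (a j - a (j + 1)) + 1 / 2 * (b j - b (j + 1)) + noise g gt ξ I xs j w)
      = 2 * ((j : ℝ) + 1) / (j + 2) * (c j - c (j + 1))
        + ((j : ℝ) + 1) * √((j : ℝ) + 3) * (e j - e (j + 1))
        + ((j : ℝ) + 1) * (a j - a (j + 1)) + ((j : ℝ) + 1) * (b j - b (j + 1))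
        + 2 * ((j : ℝ) + 1) * noise g gt ξ I xs j w := fun j _ => by ring
  rw [Finset.sum_congr rfl hsplit] at hmain
  simp only [Finset.sum_add_distrib] at hmain
  have hsup : 0 ≤ ⨆ i, om i := Real.iSup_nonneg hom
  have hdx : ∀ j, e j ≤ dX D ^ 2 := fun j => pow_le_pow_left₀ (norm_nonneg _)
    (norm_sub_le_dX hdata.bounded (hrun.step_x_mem j w) hopt.mem_dom) 2
  have tc := weighted_telescope (w := fun j : ℕ => 2 * ((j : ℝ) + 1) / (j + 2)) (c := c)
    (C := (⨆ i, om i) * dX D ^ 2) (by positivity)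
    (monotone_nat_of_le_succ fun j => by
      rw [div_le_div_iff₀ (by positivity) (by positivity)]; push_cast; nlinarith) n
    (fun j _ => (weighted_sq_le _).trans (mul_le_mul_of_nonneg_left (hdx j) hsup))
  have te := weighted_telescope (w := fun j : ℕ => ((j : ℝ) + 1) * √((j : ℝ) + 3)) (c := e)
    (C := dX D ^ 2) (by positivity)
    (monotone_nat_of_le_succ fun j => by
      push_cast
      exact mul_le_mul (by linarith) (Real.sqrt_le_sqrt (by linarith)) (by positivity)
        (by positivity)) n
    (fun j _ => hdx j)
  have ta := weighted_telescope (w := fun j : ℕ => (j : ℝ) + 1) (c := a)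
    (C := dZ D pen ^ 2) (by positivity)
    (monotone_nat_of_le_succ fun j => by push_cast; linarith) n
    (fun j _ => link_dist_le_dZ_sq hdata.bounded hpen (hrun.step_x_mem j w) hopt.mem_dom
      hopt.feasible (hrun.dual_and_link hpen (j + 1) w).2)
  -- Only `λ¹, …, λ^{n+1}` are compared with `d_λ`; the next iterate occurs solely in the
  -- nonnegative remainder `pb`, which is discarded.
  have tb := weighted_telescope (w := fun j : ℕ => (j : ℝ) + 1) (c := b)
    (C := dLam pen ρ (dualIterates I (n + 1)) ^ 2) (by positivity)
    (monotone_nat_of_le_succ fun j => by push_cast; linarith) n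
    (fun j hj => wsq_le_dLam_sq hpen hbdd hL ⟨j + 1, by omega, by omega, w, rfl⟩)
  have pc : 0 ≤ 2 * ((n : ℝ) + 1) / (n + 2) * c (n + 1) :=
    mul_nonneg (by positivity) (Finset.sum_nonneg fun p _ => mul_nonneg (hom p.1) (sq_nonneg _))
  have pe : 0 ≤ ((n : ℝ) + 1) * √((n : ℝ) + 3) * e (n + 1) := by positivity
  have pa : 0 ≤ ((n : ℝ) + 1) * a (n + 1) :=
    mul_nonneg (by positivity) (Finset.sum_nonneg fun p _ =>
      mul_nonneg (by linarith [hpen p.1]) (sq_nonneg _))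
  have pb : 0 ≤ ((n : ℝ) + 1) * b (n + 1) :=
    mul_nonneg (by positivity) (wsq_matGam_inv_nonneg hpen _)
  have hF : F (n + 1 + 1) = gap g h xs ρ I (n + 2) w := by
    simp only [F, gap]; rw [← hLR]
  rw [hF] at hmain
  push_cast at hmain
  have hn : (n : ℝ) + 1 + 1 = n + 2 := by ring
  rw [hn] at hmain
  linarith

end Accelerated

/-! ### The `x`-update is a Lipschitz function of its linear term -/

section Prox

variable {V : Type*} [Fintype V] [DecidableEq V] {G : SimpleGraph V} [DecidableRel G.Adj] {M : ℕ}

/-- The coefficient of the linear part of the objective of the `x`-update. -/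
noncomputable def linTerm (om : V → ℝ) (pen : G.Dart → ℝ) (th et : ℝ)
    (q xr : XVec V M) (zr : ZVec G M) (lr : LVec G M) : XVec V M :=
  q + app (matA G M)ᵀ (app (matGam M pen) (app (matB G M) zr + app (matGam M pen)⁻¹ lr))
    - app (th • blkDiag M om + et • (1 : Matrix (V × Fin M) (V × Fin M) ℝ)) xr

/-- Expanding the squares confines the influence of the state on the minimizer to one linear
coefficient; what remains is a fixed function of `x` and a constant. -/
lemma xObj_eq (h : V → Loc M → ℝ) (om : V → ℝ) (pen : G.Dart → ℝ) (th et : ℝ)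
    (q xr : XVec V M) (zr : ZVec G M) (lr : LVec G M) (x : XVec V M) :
    xObj h om pen th et q xr zr lr x
      = inner ℝ (linTerm om pen th et q xr zr lr) x
        + (sumBlk h x + 1 / 2 * wsq (matGam M pen) (app (matA G M) x)
          + 1 / 2 * wsq (th • blkDiag M om + et • (1 : Matrix (V × Fin M) (V × Fin M) ℝ)) x)
        + (1 / 2 * wsq (matGam M pen) (app (matB G M) zr + app (matGam M pen)⁻¹ lr)
          + 1 / 2 * wsq (th • blkDiag M om + et • (1 : Matrix (V × Fin M) (V × Fin M) ℝ)) xr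
          - inner ℝ q xr) := by
  set W := th • blkDiag M om + et • (1 : Matrix (V × Fin M) (V × Fin M) ℝ) with hWdef
  have hW : Wᵀ = W := by
    rw [hWdef, proxMatrix_eq_diagonal, Matrix.diagonal_transpose]
  have e1 : wsq W (x - xr) = wsq W x - 2 * inner ℝ x (app W xr) + wsq W xr := by
    have h1 : x - xr = x + (-1 : ℝ) • xr := by simp [sub_eq_add_neg]
    rw [h1, wsq_add hW, wsq_smul, app_smul, real_inner_smul_right]
    ring
  simp only [xObj, linTerm]
  rw [add_assoc (app (matA G M) x), wsq_add (matGam_transpose pen), ← hWdef, e1, inner_sub_right,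
    inner_sub_left, inner_add_left, inner_app, real_inner_comm x (app (matA G M)ᵀ _),
    real_inner_comm x (app W xr)]
  simp only [sumBlk]
  ring

/-- Adding the growth inequalities of the two minimizers cancels the common convex part and leaves
`et ‖x - x'‖² ≤ ⟪c' - c, x - x'⟫`; then Cauchy–Schwarz. -/
lemma norm_argmin_sub_le {D : V → Set (Loc M)} {h : V → Loc M → ℝ}
    (hh : ∀ i, ConvexOn ℝ (D i) (h i)) {om : V → ℝ} (hom : ∀ i, 0 ≤ om i) {pen : G.Dart → ℝ}
    (hpen : ∀ a, 0 < pen a) {th et : ℝ} (hth : 0 ≤ th)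
    {q xr x q' xr' x' : XVec V M} {zr zr' : ZVec G M} {lr lr' : LVec G M}
    (hx : x ∈ domH D) (hmin : IsMinOn (xObj h om pen th et q xr zr lr) (domH D) x)
    (hx' : x' ∈ domH D) (hmin' : IsMinOn (xObj h om pen th et q' xr' zr' lr') (domH D) x') :
    et * ‖x - x'‖
      ≤ ‖linTerm om pen th et q xr zr lr - linTerm om pen th et q' xr' zr' lr'‖ := by
  have h1 := xObj_growth hh hx hx' hmin
  have h2 := xObj_growth hh hx' hx hmin'
  have hΓ : ∀ v : LVec G M, 0 ≤ wsq (matGam M pen) v := fun v => by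
    rw [wsq_matGam]
    exact Finset.sum_nonneg fun p _ => mul_nonneg (hpen p.1).le (by positivity)
  have hO : ∀ v : XVec V M, 0 ≤ th * ∑ p : V × Fin M, om p.1 * v p ^ 2 := fun v =>
    mul_nonneg hth (Finset.sum_nonneg fun p _ => mul_nonneg (hom p.1) (sq_nonneg _))
  rw [wsq_proxMatrix, xObj_eq, xObj_eq] at h1 h2
  set c := linTerm om pen th et q xr zr lr
  set c' := linTerm om pen th et q' xr' zr' lr'
  have h3 : et * ‖x - x'‖ ^ 2 ≤ inner ℝ (c' - c) (x - x') := by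
    rw [inner_sub_left, inner_sub_right, inner_sub_right]
    rw [norm_sub_rev x' x] at h1
    linarith [hΓ (app (matA G M) (x' - x)), hΓ (app (matA G M) (x - x')), hO (x' - x), hO (x - x')]
  have h4 := real_inner_le_norm (c' - c) (x - x')
  rw [norm_sub_rev c' c] at h4
  rcases (norm_nonneg (x - x')).eq_or_lt with h5 | h5
  · rw [← h5, mul_zero]; exact norm_nonneg _
  · exact le_of_mul_le_mul_right (by nlinarith) h5

/-- The `x`-update is given by a continuous function of the linear term of its objective. -/
lemma exists_continuous_argmin {D : V → Set (Loc M)} {h : V → Loc M → ℝ}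
    (hh : ∀ i, ConvexOn ℝ (D i) (h i)) {om : V → ℝ} (hom : ∀ i, 0 ≤ om i) {pen : G.Dart → ℝ}
    (hpen : ∀ a, 0 < pen a) {th et : ℝ} (hth : 0 ≤ th) (het : 0 < et) :
    ∃ T : XVec V M → XVec V M, Continuous T ∧
      ∀ (q xr : XVec V M) (zr : ZVec G M) (lr : LVec G M) (x : XVec V M), x ∈ domH D →
        IsMinOn (xObj h om pen th et q xr zr lr) (domH D) x →
        x = T (linTerm om pen th et q xr zr lr) := by
  classical
  let s : Set (XVec V M) := {c | ∃ (q xr : XVec V M) (zr : ZVec G M) (lr : LVec G M)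
    (x : XVec V M), c = linTerm om pen th et q xr zr lr ∧ x ∈ domH D ∧
      IsMinOn (xObj h om pen th et q xr zr lr) (domH D) x}
  have hs : ∀ c : XVec V M, ∃ x : XVec V M, c ∈ s → ∃ (q xr : XVec V M) (zr : ZVec G M)
      (lr : LVec G M), c = linTerm om pen th et q xr zr lr ∧ x ∈ domH D ∧
      IsMinOn (xObj h om pen th et q xr zr lr) (domH D) x := by
    intro c
    by_cases hc : c ∈ s
    · obtain ⟨q, xr, zr, lr, x, hx⟩ := hc
      exact ⟨x, fun _ => ⟨q, xr, zr, lr, hx⟩⟩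
    · exact ⟨0, fun h => absurd h hc⟩
  choose f hf using hs
  -- The set `s` of coefficients admitting a minimizer is arbitrary, so `f` is controlled only
  -- there; a Lipschitz extension makes it continuous on the whole space.
  have hlip : LipschitzOnWith (Real.toNNReal (1 / et)) f s := by
    refine LipschitzOnWith.of_dist_le_mul fun c hc c' hc' => ?_
    obtain ⟨q, xr, zr, lr, e, hx, hm⟩ := hf c hc
    obtain ⟨q', xr', zr', lr', e', hx', hm'⟩ := hf c' hc'
    have := norm_argmin_sub_le hh hom hpen hth hx hm hx' hm'
    rw [← e, ← e'] at this
    rw [dist_eq_norm, dist_eq_norm, Real.coe_toNNReal _ (by positivity), one_div,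
      ← div_eq_inv_mul, le_div_iff₀ het, mul_comm]
    exact this
  obtain ⟨T, hT, hTf⟩ := hlip.extend_finite_dimension
  refine ⟨T, hT.continuous, fun q xr zr lr x hx hm => ?_⟩
  have hc : linTerm om pen th et q xr zr lr ∈ s := ⟨q, xr, zr, lr, x, rfl, hx, hm⟩
  rw [← hTf hc]
  obtain ⟨q', xr', zr', lr', e, hx', hm'⟩ := hf _ hc
  have := norm_argmin_sub_le hh hom hpen hth hx hm hx' hm'
  rw [← e, sub_self, norm_zero] at this
  exact sub_eq_zero.1 (norm_le_zero_iff.1 (by nlinarith [norm_nonneg (x - f (linTerm om pen th et q xr zr lr))]))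

end Prox

/-! ### Measurability of the iterates -/

section Measurability

variable {V : Type*} [Fintype V] [DecidableEq V] {G : SimpleGraph V} [DecidableRel G.Adj] {M : ℕ}

lemma continuous_stack : Continuous (stack : (V → Loc M) → XVec V M) := by
  unfold stack; fun_prop

lemma measurable_stochGrad {S : V → Type*} [∀ i, MeasurableSpace (S i)]
    {gt : ∀ i, Loc M → S i → Loc M} (hgt : ∀ i, Measurable (Function.uncurry (gt i))) :
    Measurable fun p : XVec V M × (∀ i, S i) => stochGrad gt p.1 p.2 := by
  refine continuous_stack.measurable.comp (measurable_pi_lambda _ fun i => ?_)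
  exact (hgt i).comp (((continuous_blk i).measurable.comp measurable_fst).prodMk
    ((measurable_pi_apply i).comp measurable_snd))

lemma measurable_gradient {E : Type*} [NormedAddCommGroup E] [InnerProductSpace ℝ E]
    [CompleteSpace E] [MeasurableSpace E] [BorelSpace E] (g : E → ℝ) : Measurable (gradient g) :=
  (InnerProductSpace.toDual ℝ E).symm.continuous.measurable.comp (measurable_fderiv ℝ g)

lemma measurable_trueGrad (g : V → Loc M → ℝ) : Measurable (trueGrad (M := M) g) :=
  continuous_stack.measurable.comp (measurable_pi_lambda _ fun i =>
    (measurable_gradient (g i)).comp (continuous_blk i).measurable)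

lemma measurable_combination {ι Om : Type*} [Fintype ι] {m : MeasurableSpace Om} (a b : ℝ)
    {f f' : Om → EuclideanSpace ℝ ι} (hf : Measurable f) (hf' : Measurable f') :
    Measurable fun w => a • f w + b • f' w :=
  (hf.const_smul a).add (hf'.const_smul b)

lemma measurable_linTerm {Om : Type*} {m : MeasurableSpace Om} (om : V → ℝ) (pen : G.Dart → ℝ)
    (th et : ℝ) {q xr : Om → XVec V M} {zr : Om → ZVec G M} {lr : Om → LVec G M}
    (hq : Measurable q) (hx : Measurable xr) (hz : Measurable zr) (hl : Measurable lr) :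
    Measurable fun w => linTerm om pen th et (q w) (xr w) (zr w) (lr w) := by
  unfold linTerm
  exact (hq.add ((continuous_app _).measurable.comp ((continuous_app _).measurable.comp
    (((continuous_app _).measurable.comp hz).add ((continuous_app _).measurable.comp hl))))).sub
    ((continuous_app _).measurable.comp hx)

variable {D : V → Set (Loc M)} {g h : V → Loc M → ℝ} {P : V → ℝ}
  {S : V → Type*} [∀ i, MeasurableSpace (S i)] {Om : Type*}
  {gt : ∀ i, Loc M → S i → Loc M} {ξ : ℕ → ∀ i, Om → S i}
  {om : V → ℝ} {pen : G.Dart → ℝ} {nu theta eta : ℕ → ℝ}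
  {x0 xag0 : XVec V M} {lam0 lamag0 : LVec G M} {I : Iterates G M Om}

/-- The state of the algorithm after `r` iterations is measurable. -/
structure MeasurableState (m : MeasurableSpace Om) (I : Iterates G M Om) (r : ℕ) : Prop where
  x : Measurable[m] (I.x r)
  xag : Measurable[m] (I.xag r)
  z : Measurable[m] (I.z r)
  zag : Measurable[m] (I.zag r)
  lam : Measurable[m] (I.lam r)

lemma IsRun.measurable_xmd {m : MeasurableSpace Om}
    (hrun : IsRun D h gt ξ om pen nu theta eta x0 xag0 lam0 lamag0 I) {r : ℕ}
    (hI : MeasurableState m I r) : Measurable[m] (I.xmd (r + 1)) := by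
  rw [funext (hrun.step_xmd r)]
  exact measurable_combination _ _ hI.xag hI.x

lemma IsRun.measurableState_succ {m : MeasurableSpace Om} (hh : ∀ i, ConvexOn ℝ (D i) (h i))
    (hgt : ∀ i, Measurable (Function.uncurry (gt i))) (hom : ∀ i, 0 ≤ om i)
    (hpen : ∀ a, 0 < pen a) (hrun : IsRun D h gt ξ om pen nu theta eta x0 xag0 lam0 lamag0 I)
    {r : ℕ} (hth : 0 ≤ theta r) (het : 0 < eta (r + 1)) (hI : MeasurableState m I r)
    (hξ : Measurable fun w i => ξ (r + 1) i w) : MeasurableState m I (r + 1) := by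
  obtain ⟨T, hT, hTx⟩ := exists_continuous_argmin (G := G) hh hom hpen hth het
  have hx : Measurable (I.x (r + 1)) := by
    rw [funext fun w => hTx _ _ _ _ _ (hrun.step_x_mem r w) (hrun.step_x r w)]
    exact hT.measurable.comp (measurable_linTerm om pen _ _
      ((measurable_stochGrad hgt).comp ((hrun.measurable_xmd hI).prodMk hξ)) hI.x hI.z hI.lam)
  have hz : Measurable (I.z (r + 1)) := by
    have e : I.z (r + 1) = fun w => (1 / 2 : ℝ) • app (matMplus G M)ᵀ (I.x (r + 1) w) :=
      funext fun w => (hrun.dual_and_link hpen (r + 1) w).2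
    rw [e]
    exact ((continuous_app (matMplus G M)ᵀ).measurable.comp hx).const_smul (1 / 2 : ℝ)
  refine ⟨hx, ?_, hz, ?_, ?_⟩
  · rw [funext (hrun.step_xag r)]
    exact measurable_combination _ _ hI.xag hx
  · rw [funext (hrun.step_zag r)]
    exact measurable_combination _ _ hI.zag hz
  · rw [funext (hrun.step_lam r)]
    exact hI.lam.add ((continuous_app (matGam M pen)).measurable.comp
      (((continuous_app (matA G M)).measurable.comp hx).add
        ((continuous_app (matB G M)).measurable.comp hz)))

/-- The information in the first `r` samples. -/
abbrev pastSigma (ξ : ℕ → ∀ i, Om → S i) (r : ℕ) : MeasurableSpace Om :=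
  ⨆ t ∈ Set.Iio r, MeasurableSpace.comap (fun w i => ξ (t + 1) i w) inferInstance

/-- Each state depends on the samples already drawn and on nothing else, which makes the next sample
independent of it. -/
lemma IsRun.measurableState (hh : ∀ i, ConvexOn ℝ (D i) (h i))
    (hgt : ∀ i, Measurable (Function.uncurry (gt i))) (hom : ∀ i, 0 ≤ om i)
    (hpen : ∀ a, 0 < pen a) (hrun : IsRun D h gt ξ om pen nu theta eta x0 xag0 lam0 lamag0 I)
    (hth : ∀ r, 0 ≤ theta r) (het : ∀ r, 0 < eta (r + 1)) (r : ℕ) :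
    MeasurableState (pastSigma ξ r) I r := by
  induction r with
  | zero =>
    constructor
    · rw [funext hrun.init_x]; exact measurable_const
    · rw [funext hrun.init_xag]; exact measurable_const
    · rw [funext hrun.init_z]; exact measurable_const
    · rw [funext hrun.init_zag]; exact measurable_const
    · rw [funext hrun.init_lam]; exact measurable_const
  | succ r ih =>
    have hle : pastSigma ξ r ≤ pastSigma ξ (r + 1) :=
      biSup_mono fun t ht => Set.mem_Iio.2 (Nat.lt_succ_of_lt ht)
    refine hrun.measurableState_succ hh hgt hom hpen (hth r) (het r)
      ⟨ih.x.mono hle le_rfl, ih.xag.mono hle le_rfl, ih.z.mono hle le_rfl,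
        ih.zag.mono hle le_rfl, ih.lam.mono hle le_rfl⟩ ?_
    refine Measurable.mono (comap_measurable _) ?_ le_rfl
    exact le_biSup (fun t => MeasurableSpace.comap (fun w i => ξ (t + 1) i w) inferInstance)
      (Set.mem_Iio.2 (Nat.lt_succ_self r))

lemma pastSigma_le [mOm : MeasurableSpace Om] (hξ : ∀ t i, Measurable (ξ (t + 1) i)) (r : ℕ) :
    pastSigma ξ r ≤ mOm :=
  iSup₂_le fun t _ => (measurable_pi_lambda _ fun i => hξ t i).comap_le

lemma indepFun_past [MeasurableSpace Om] {μ : Measure Om}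
    (hξ : ∀ t i, Measurable (ξ (t + 1) i))
    (hind : iIndepFun (fun (t : ℕ) (w : Om) (i : V) => ξ (t + 1) i w) μ) {r : ℕ}
    {β : Type*} [MeasurableSpace β] {U : Om → β} (hU : Measurable[pastSigma ξ r] U) :
    IndepFun U (fun w i => ξ (r + 1) i w) μ := by
  rw [IndepFun_iff_Indep]
  have h1 := indep_iSup_of_disjoint
    (fun t => (measurable_pi_lambda _ fun i => hξ t i : Measurable fun w i => ξ (t + 1) i w).comap_le)
    ((iIndepFun_iff_iIndep _ _ _).1 hind)
    -- The family is shifted by one: its indices below `r` are the samples `1, …, r`, and index `r`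
    -- is the fresh sample `r + 1`.
    (S := Set.Iio r) (T := {r}) (by simp)
  refine indep_of_indep_of_le_right (indep_of_indep_of_le_left h1 hU.comap_le) ?_
  exact le_biSup (fun t => MeasurableSpace.comap (fun w i => ξ (t + 1) i w) inferInstance)
      (Set.mem_singleton r)

end Measurability

/-! ### Independent variables -/

section Independence

variable {Om α β : Type*} [MeasurableSpace Om] [MeasurableSpace α] [MeasurableSpace β]
  {μ : Measure Om} [IsProbabilityMeasure μ] {X : Om → α} {Y : Om → β}

/-- The joint law is a product, so Tonelli allows `X` to be frozen. No integrability is assumed, so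
this can establish the finite second moment of the error. -/
lemma lintegral_comp_indepFun (hX : Measurable X) (hY : Measurable Y) (hXY : IndepFun X Y μ)
    {F : α × β → ENNReal} (hF : Measurable F) :
    ∫⁻ w, F (X w, Y w) ∂μ = ∫⁻ w, ∫⁻ w', F (X w, Y w') ∂μ ∂μ := by
  have := Measure.isProbabilityMeasure_map (μ := μ) hY.aemeasurable
  have h1 := (indepFun_iff_map_prod_eq_prod_map_map hX.aemeasurable hY.aemeasurable).1 hXY
  rw [← lintegral_map hF (hX.prodMk hY), h1, lintegral_prod _ hF.aemeasurable,
    lintegral_map hF.lintegral_prod_right' hX]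
  refine lintegral_congr fun w => ?_
  exact lintegral_map (hF.comp measurable_prodMk_left) hY

lemma integral_comp_indepFun (hX : Measurable X) (hY : Measurable Y) (hXY : IndepFun X Y μ)
    {F : α × β → ℝ} (hF : Measurable F) (hint : Integrable (fun w => F (X w, Y w)) μ) :
    ∫ w, F (X w, Y w) ∂μ = ∫ w, ∫ w', F (X w, Y w') ∂μ ∂μ := by
  have := Measure.isProbabilityMeasure_map (μ := μ) hY.aemeasurable
  have h1 := (indepFun_iff_map_prod_eq_prod_map_map hX.aemeasurable hY.aemeasurable).1 hXY
  have h2 : Integrable F ((μ.map X).prod (μ.map Y)) := by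
    rw [← h1]
    exact (integrable_map_measure hF.aestronglyMeasurable (hX.prodMk hY).aemeasurable).2 hint
  rw [← integral_map (hX.prodMk hY).aemeasurable hF.aestronglyMeasurable, h1, integral_prod _ h2,
    integral_map hX.aemeasurable
      hF.stronglyMeasurable.integral_prod_right'.aestronglyMeasurable]
  refine integral_congr_ae (Filter.Eventually.of_forall fun w => ?_)
  exact integral_map hY.aemeasurable (hF.comp measurable_prodMk_left).aestronglyMeasurable

end Independence

/-! ### The stochastic error -/

section Noise

variable {V : Type*} [Fintype V] [DecidableEq V] {G : SimpleGraph V} [DecidableRel G.Adj] {M : ℕ}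
  {D : V → Set (Loc M)} {g h : V → Loc M → ℝ} {P : V → ℝ}
  {S : V → Type*} [∀ i, MeasurableSpace (S i)] {Om : Type*} [MeasurableSpace Om]
  {μ : Measure Om} [IsProbabilityMeasure μ]
  {gt : ∀ i, Loc M → S i → Loc M} {ξ : ℕ → ∀ i, Om → S i} {σ : ℝ}
  {om : V → ℝ} {pen : G.Dart → ℝ} {theta eta : ℕ → ℝ}
  {x0 xag0 : XVec V M} {lam0 lamag0 : LVec G M} {I : Iterates G M Om}

/-- The pairing is a sum over agents, so unbiasedness of each agent suffices, whatever the
dependence between agents. -/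
lemma IsOracle.integral_inner_error (horacle : IsOracle μ D g gt ξ σ) (t : ℕ) {y : XVec V M}
    (hy : y ∈ domH D) (v : XVec V M) :
    ∫ w, inner ℝ (stochGrad gt y (fun i => ξ (t + 1) i w) - trueGrad g y) v ∂μ = 0 := by
  have hint : ∀ i, Integrable (fun w => gt i (blk y i) (ξ (t + 1) i w) - gradient (g i) (blk y i)) μ :=
    fun i => (horacle.integrable t i _ (hy i)).sub (integrable_const _)
  have e : ∀ w, inner ℝ (stochGrad gt y (fun i => ξ (t + 1) i w) - trueGrad g y) v
      = ∑ i, inner ℝ (blk v i) (gt i (blk y i) (ξ (t + 1) i w) - gradient (g i) (blk y i)) := by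
    intro w
    rw [real_inner_comm, inner_eq_sum_blk]
    rfl
  simp only [e]
  rw [integral_finsetSum _ fun i _ => (hint i).const_inner _]
  refine Finset.sum_eq_zero fun i _ => ?_
  rw [integral_inner (hint i), integral_sub (horacle.integrable t i _ (hy i)) (integrable_const _),
    horacle.unbiased t i _ (hy i)]
  simp

/-- The stochastic error contributes at most its variance term in expectation. -/
lemma IsRun.integral_noise_le (hdata : IsData D g h P) (horacle : IsOracle μ D g gt ξ σ)
    (hom : ∀ i, 0 ≤ om i) (hpen : ∀ a, 0 < pen a)
    (hrun : IsRun D h gt ξ om pen (fun r : ℕ => 2 / ((r : ℝ) + 1)) theta eta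
      x0 xag0 lam0 lamag0 I) (hth : ∀ r, 0 ≤ theta r) (het : ∀ r, 0 < eta (r + 1))
    {xs : XVec V M} (hxs : xs ∈ domH D) (j : ℕ) :
    Integrable (noise g gt ξ I xs j) μ ∧
      ∫ w, noise g gt ξ I xs j w ∂μ ≤ σ ^ 2 / (2 * √((j : ℝ) + 3)) := by
  have hst := hrun.measurableState hdata.h_convex horacle.gt_meas hom hpen hth het (j + 1)
  have hxmd := fun w => hrun.xmd_mem (fun i => (hdata.h_convex i).1) j w
  have hUm : Measurable[pastSigma ξ (j + 1)] fun w => (I.xmd (j + 2) w, I.x (j + 1) w) :=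
    (hrun.measurable_xmd hst).prodMk hst.x
  have hU : Measurable fun w => (I.xmd (j + 2) w, I.x (j + 1) w) :=
    hUm.mono (pastSigma_le horacle.ξ_meas _) le_rfl
  have hZ : Measurable fun w i => ξ (j + 1 + 1) i w :=
    measurable_pi_lambda _ fun i => horacle.ξ_meas (j + 1) i
  have hind : IndepFun (fun w => (I.xmd (j + 2) w, I.x (j + 1) w)) (fun w i => ξ (j + 1 + 1) i w) μ :=
    indepFun_past horacle.ξ_meas horacle.indep hUm
  let E : (XVec V M × XVec V M) × (∀ i, S i) → XVec V M := fun p =>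
    stochGrad gt p.1.1 p.2 - trueGrad g p.1.1
  have hE : Measurable E := ((measurable_stochGrad horacle.gt_meas).comp
    ((measurable_fst.comp measurable_fst).prodMk measurable_snd)).sub
    ((measurable_trueGrad g).comp (measurable_fst.comp measurable_fst))
  have hδ : Measurable (gradError g gt ξ I j) := hE.comp (hU.prodMk hZ)
  -- Working with the lower integral gives integrability of the squared error and its variance bound
  -- at once.
  have hlin : ∫⁻ w, ENNReal.ofReal (‖gradError g gt ξ I j w‖ ^ 2) ∂μ ≤ ENNReal.ofReal (σ ^ 2) := by
    have h1 := lintegral_comp_indepFun hU hZ hind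
      (F := fun p => ENNReal.ofReal (‖E p‖ ^ 2)) (hE.norm.pow_const 2).ennreal_ofReal
    refine h1.trans_le ?_
    refine (lintegral_mono (g := fun _ => ENNReal.ofReal (σ ^ 2)) fun w => ?_).trans_eq (by simp)
    have h2 := horacle.sq_integrable (j + 1) _ (hxmd w)
    simp only [E]
    rw [← ofReal_integral_eq_lintegral_ofReal h2
      (Filter.Eventually.of_forall fun _ => sq_nonneg _)]
    exact ENNReal.ofReal_le_ofReal (horacle.variance_le (j + 1) _ (hxmd w))
  have hnn : 0 ≤ᵐ[μ] fun w => ‖gradError g gt ξ I j w‖ ^ 2 :=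
    Filter.Eventually.of_forall fun _ => sq_nonneg _
  have hsq : Integrable (fun w => ‖gradError g gt ξ I j w‖ ^ 2) μ := by
    refine ⟨(hδ.norm.pow_const 2).aestronglyMeasurable, ?_⟩
    rw [hasFiniteIntegral_iff_ofReal hnn]
    exact hlin.trans_lt ENNReal.ofReal_lt_top
  have hsq_le : ∫ w, ‖gradError g gt ξ I j w‖ ^ 2 ∂μ ≤ σ ^ 2 := by
    rw [integral_eq_lintegral_of_nonneg_ae hnn (hδ.norm.pow_const 2).aestronglyMeasurable]
    exact ENNReal.toReal_le_of_le_ofReal (sq_nonneg _) hlin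
  have hx : Measurable (I.x (j + 1)) := measurable_snd.comp hU
  have hinner : Integrable (fun w => inner ℝ (gradError g gt ξ I j w) (I.x (j + 1) w - xs)) μ := by
    -- Domination by `d_x (1 + ‖δ‖²)`, with `δ` the gradient error, from `‖δ‖ ≤ 1 + ‖δ‖²`.
    refine Integrable.mono' (((integrable_const (1 : ℝ)).add hsq).const_mul (dX D))
      (hδ.inner (hx.sub_const xs)).aestronglyMeasurable (Filter.Eventually.of_forall fun w => ?_)
    have h1 := norm_sub_le_dX hdata.bounded (hrun.step_x_mem j w) hxs
    have h0 : 0 ≤ dX D := (norm_nonneg _).trans h1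
    refine (norm_inner_le_norm _ _).trans ?_
    rw [mul_comm]
    simp only [Pi.add_apply]
    refine mul_le_mul h1 ?_ (norm_nonneg _) h0
    nlinarith [sq_nonneg (‖gradError g gt ξ I j w‖ - 1)]
  have hzero : ∫ w, inner ℝ (gradError g gt ξ I j w) (I.x (j + 1) w - xs) ∂μ = 0 := by
    have h1 := integral_comp_indepFun hU hZ hind
      (F := fun p => inner ℝ (E p) (p.1.2 - xs))
      (hE.inner ((measurable_snd.comp measurable_fst).sub_const xs)) hinner
    refine h1.trans (integral_eq_zero_of_ae (Filter.Eventually.of_forall fun w => ?_))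
    exact horacle.integral_inner_error (j + 1) (hxmd w) (I.x (j + 1) w - xs)
  refine ⟨(hsq.div_const _).sub hinner, ?_⟩
  simp only [noise]
  rw [integral_sub (hsq.div_const _) hinner, hzero, sub_zero, integral_div]
  gcongr

end Noise

/-! ### The objective: measurability and boundedness from below -/

section Objective

/-- A function with closed epigraph is measurable along measurable maps into its domain. -/
lemma measurable_comp_of_isClosed_epigraph {E Om : Type*} [TopologicalSpace E]
    [SecondCountableTopology E] [MeasurableSpace E] [BorelSpace E] [MeasurableSpace Om]
    {s : Set E} {h : E → ℝ} (hc : IsClosed {p : E × ℝ | p.1 ∈ s ∧ h p.1 ≤ p.2}) {Y : Om → E}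
    (hY : Measurable Y) (hYs : ∀ w, Y w ∈ s) : Measurable fun w => h (Y w) := by
  refine measurable_of_Iic fun c => ?_
  have : (fun w => h (Y w)) ⁻¹' Set.Iic c
      = (fun w => (Y w, c)) ⁻¹' {p : E × ℝ | p.1 ∈ s ∧ h p.1 ≤ p.2} := by
    ext w; simp [hYs w]
  rw [this]
  exact (hY.prodMk measurable_const) hc.measurableSet

/-- A function with closed epigraph and bounded domain is bounded below. -/
lemma exists_lower_bound_of_isClosed_epigraph {E : Type*} [PseudoMetricSpace E] [ProperSpace E]
    {s : Set E} {h : E → ℝ} (hc : IsClosed {p : E × ℝ | p.1 ∈ s ∧ h p.1 ≤ p.2})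
    (hs : Bornology.IsBounded s) : ∃ c, ∀ y ∈ s, c ≤ h y := by
  by_contra! hcon
  -- If `h` had no lower bound, these nested compact sublevel sets would share a point, where the
  -- real number `h y` would lie below every `-n`.
  let t : ℕ → Set E := fun n => {y | y ∈ s ∧ h y ≤ -(n : ℝ)}
  have htc : ∀ n, IsClosed (t n) := fun n =>
    hc.preimage (by fun_prop : Continuous fun y : E => (y, -(n : ℝ)))
  have hne := IsCompact.nonempty_iInter_of_sequence_nonempty_isCompact_isClosed t
    (fun n y hy => ⟨hy.1, hy.2.trans (by push_cast; linarith)⟩)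
    (fun n => by obtain ⟨y, hy, hlt⟩ := hcon (-(n : ℝ)); exact ⟨y, hy, hlt.le⟩)
    (Metric.isCompact_of_isClosed_isBounded (htc 0) (hs.subset fun y hy => hy.1)) htc
  obtain ⟨y, hy⟩ := hne
  obtain ⟨n, hn⟩ := exists_nat_gt (-(h y))
  have := (Set.mem_iInter.1 hy n).2
  linarith

lemma exists_lower_bound_of_continuous {E : Type*} [PseudoMetricSpace E] [ProperSpace E]
    {s : Set E} {g : E → ℝ} (hg : Continuous g) (hs : Bornology.IsBounded s) :
    ∃ c, ∀ y ∈ s, c ≤ g y := by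
  obtain ⟨c, hc⟩ := (hs.isCompact_closure.image hg).bddBelow
  exact ⟨c, fun y hy => hc ⟨y, subset_closure hy, rfl⟩⟩

variable {V : Type*} [Fintype V] {M : ℕ} {D : V → Set (Loc M)} {g h : V → Loc M → ℝ} {P : V → ℝ}

/-- The recursion bounds the gap only from above; integrability also needs this bound from below. -/
lemma IsData.exists_le_obj (hdata : IsData D g h P) : ∃ c, ∀ x ∈ domH D, c ≤ obj g h x := by
  choose a ha using fun i =>
    exists_lower_bound_of_continuous (hdata.g_diff i).continuous (hdata.bounded i)
  choose b hb using fun i =>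
    exists_lower_bound_of_isClosed_epigraph (hdata.h_lsc i) (hdata.bounded i)
  exact ⟨∑ i, (a i + b i), fun x hx =>
    Finset.sum_le_sum fun i _ => add_le_add (ha i _ (hx i)) (hb i _ (hx i))⟩

lemma IsData.measurable_obj (hdata : IsData D g h P) {Om : Type*} [MeasurableSpace Om]
    {Y : Om → XVec V M} (hY : Measurable Y) (hYD : ∀ w, Y w ∈ domH D) :
    Measurable fun w => obj g h (Y w) := by
  classical
  unfold obj
  refine Finset.measurable_sum _ fun i _ => ?_
  have hb : Measurable fun w => blk (Y w) i := (continuous_blk i).measurable.comp hY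
  exact ((hdata.g_diff i).continuous.measurable.comp hb).add
    (measurable_comp_of_isClosed_epigraph (hdata.h_lsc i) hb fun w => hYD w i)

end Objective

/-- The weighted constants of the summed recursion are at most those of the rate. -/
lemma rate_le (n : ℕ) {d o e s : ℝ} (hd : 0 ≤ d) (ho : 0 ≤ o) (he : 0 ≤ e) :
    (((n : ℝ) + 1) * d + 2 * ((n : ℝ) + 1) / (n + 2) * o + ((n : ℝ) + 1) * √((n : ℝ) + 3) * e
        + s * (2 / 3 * ((n : ℝ) + 1) * √((n : ℝ) + 2))) / (((n : ℝ) + 1) * (n + 2))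
      ≤ 1 / ((n : ℝ) + 1) * (d + 2 / ((n : ℝ) + 2) * o) + 2 * s / 3 * (1 / √((n : ℝ) + 2))
        + √((n : ℝ) + 2) / ((n : ℝ) + 1) * e := by
  have hn : (0 : ℝ) ≤ n := Nat.cast_nonneg n
  have a2 : 0 < √((n : ℝ) + 2) := Real.sqrt_pos.2 (by positivity)
  have s2 : √((n : ℝ) + 2) ^ 2 = n + 2 := Real.sq_sqrt (by positivity)
  have h1 : ((n : ℝ) + 1) * d / (((n : ℝ) + 1) * (n + 2)) ≤ 1 / ((n : ℝ) + 1) * d := by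
    rw [mul_div_mul_left _ _ (by positivity), one_div_mul_eq_div]
    exact div_le_div_of_nonneg_left hd (by positivity) (by linarith)
  have h2 : 2 * ((n : ℝ) + 1) / (n + 2) * o / (((n : ℝ) + 1) * (n + 2))
      ≤ 1 / ((n : ℝ) + 1) * (2 / ((n : ℝ) + 2) * o) := by
    have : 2 * ((n : ℝ) + 1) / (n + 2) * o / (((n : ℝ) + 1) * (n + 2))
        = 1 / ((n : ℝ) + 2) * (2 / ((n : ℝ) + 2) * o) := by field_simp
    rw [this]
    exact mul_le_mul_of_nonneg_right
      (one_div_le_one_div_of_le (by positivity) (by linarith)) (by positivity)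
  have h3 : ((n : ℝ) + 1) * √((n : ℝ) + 3) * e / (((n : ℝ) + 1) * (n + 2))
      ≤ √((n : ℝ) + 2) / ((n : ℝ) + 1) * e := by
    have : ((n : ℝ) + 1) * √((n : ℝ) + 3) * e / (((n : ℝ) + 1) * (n + 2))
        = √((n : ℝ) + 3) / ((n : ℝ) + 2) * e := by field_simp
    rw [this]
    refine mul_le_mul_of_nonneg_right ?_ he
    rw [div_le_div_iff₀ (by positivity) (by positivity)]
    -- After squaring, the claim is `(n+3)(n+1)² ≤ (n+2)³`.
    refine pow_le_pow_iff_left₀ (by positivity) (by positivity) two_ne_zero |>.1 ?_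
    rw [mul_pow, mul_pow, s2, Real.sq_sqrt (by positivity)]
    nlinarith
  have h4 : s * (2 / 3 * ((n : ℝ) + 1) * √((n : ℝ) + 2)) / (((n : ℝ) + 1) * (n + 2))
      = 2 * s / 3 * (1 / √((n : ℝ) + 2)) := by
    field_simp
    rw [s2]
  rw [add_div, add_div, add_div, h4, mul_add (1 / ((n : ℝ) + 1))]
  linarith

end DySPGC

/-! ### The convergence rate in expectation -/

theorem theorem6p1 {V : Type*} [Fintype V] [DecidableEq V]
    (G : SimpleGraph V) [DecidableRel G.Adj] (hG : G.Connected) (M : ℕ)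
    (D : V → Set (Loc M)) (g h : V → Loc M → ℝ) (P : V → ℝ) (hdata : IsData D g h P)
    (xs : XVec V M) (zs : ZVec G M) (hopt : IsOptimal G D g h xs zs)
    {S : V → Type*} [∀ i, MeasurableSpace (S i)]
    {Om : Type*} [MeasurableSpace Om] (μ : Measure Om) [IsProbabilityMeasure μ]
    (gt : ∀ i, Loc M → S i → Loc M) (ξ : ℕ → ∀ i, Om → S i) (σ : ℝ)
    (horacle : IsOracle μ D g gt ξ σ)
    (om : V → ℝ) (hom : ∀ i, 0 ≤ om i) (pen : G.Dart → ℝ) (hpen : ∀ a, 0 < pen a)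
    (hstep : ((4 : ℝ) • blkDiag M om + matMplus G M * matXi M pen * (matMplus G M)ᵀ
      - (4 : ℝ) • blkDiag M P).PosDef)
    (x0 xag0 : XVec V M) (lam0 lamag0 : LVec G M) (I : Iterates G M Om)
    (hrun : IsRun D h gt ξ om pen
      (fun r : ℕ => 2 / ((r : ℝ) + 1)) (fun r : ℕ => 2 / ((r : ℝ) + 1))
      (fun r : ℕ => √((r : ℝ) + 1)) x0 xag0 lam0 lamag0 I)
    (ρ : ℝ) (hρ : 0 < ρ) (r : ℕ) (hr : 1 ≤ r) :
    (∀ w, I.xag (r + 1) w ∈ domH D) ∧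
    BddAbove (dualDist pen ρ (dualIterates I r)) ∧
    Integrable (fun w => gap g h xs ρ I (r + 1) w) μ ∧
    ∫ w, gap g h xs ρ I (r + 1) w ∂μ ≤
      1 / (r : ℝ) * (dZ D pen ^ 2 + dLam pen ρ (dualIterates I r) ^ 2
          + 2 / ((r : ℝ) + 1) * ((⨆ i, om i) * dX D ^ 2))
        + 2 * σ ^ 2 / 3 * (1 / √((r : ℝ) + 1))
        + √((r : ℝ) + 1) / (r : ℝ) * dX D ^ 2 := by
  obtain ⟨n, rfl⟩ : ∃ n, r = n + 1 := ⟨r - 1, by omega⟩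
  have hmem : ∀ w, I.xag (n + 1 + 1) w ∈ domH D :=
    fun w => hrun.xag_mem (fun i => (hdata.h_convex i).1) n w
  have hth : ∀ r : ℕ, (0 : ℝ) ≤ 2 / ((r : ℝ) + 1) := fun r => by positivity
  have het : ∀ r : ℕ, 0 < √(((r + 1 : ℕ) : ℝ) + 1) := fun r => by positivity
  have hnoise := hrun.integral_noise_le hdata horacle hom hpen hth het hopt.mem_dom
  set K : ℝ := ((n : ℝ) + 1) * (dZ D pen ^ 2 + dLam pen ρ (dualIterates I (n + 1)) ^ 2)
    + 2 * ((n : ℝ) + 1) / (n + 2) * ((⨆ i, om i) * dX D ^ 2)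
    + ((n : ℝ) + 1) * √((n : ℝ) + 3) * dX D ^ 2 with hK
  set N : Om → ℝ := fun w =>
    ∑ j ∈ Finset.range (n + 1), 2 * ((j : ℝ) + 1) * noise g gt ξ I xs j w with hN
  have hpos : 0 < ((n : ℝ) + 1) * (n + 2) := by positivity
  have hupper : ∀ w, gap g h xs ρ I (n + 1 + 1) w ≤ (K + N w) / (((n : ℝ) + 1) * (n + 2)) := by
    intro w
    rw [le_div_iff₀ hpos, mul_comm]
    exact hrun.gap_le hdata hom hpen hstep hopt hρ n w
  have hNint : Integrable N μ :=
    integrable_finsetSum _ fun j _ => (hnoise j).1.const_mul _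
  have hUint : Integrable (fun w => (K + N w) / (((n : ℝ) + 1) * (n + 2))) μ :=
    ((integrable_const K).add hNint).div_const _
  have hint : Integrable (fun w => gap g h xs ρ I (n + 1 + 1) w) μ := by
    obtain ⟨c, hc⟩ := hdata.exists_le_obj
    have hst := hrun.measurableState hdata.h_convex horacle.gt_meas hom hpen hth het (n + 1 + 1)
    have hle := pastSigma_le horacle.ξ_meas (n + 1 + 1)
    have hmx : Measurable (I.xag (n + 1 + 1)) := hst.xag.mono hle le_rfl
    have hmz : Measurable (I.zag (n + 1 + 1)) := hst.zag.mono hle le_rfl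
    have hmeas : Measurable fun w => gap g h xs ρ I (n + 1 + 1) w :=
      ((hdata.measurable_obj hmx hmem).sub_const _).add
        ((((continuous_app (matA G M)).measurable.comp hmx).add
          ((continuous_app (matB G M)).measurable.comp hmz)).norm.const_mul ρ)
    -- The gap is measurable and lies between a constant and an integrable function.
    refine Integrable.mono' ((integrable_const |c - obj g h xs|).add hUint.abs)
      hmeas.aestronglyMeasurable (Filter.Eventually.of_forall fun w => ?_)
    have h1 : c - obj g h xs ≤ gap g h xs ρ I (n + 1 + 1) w := by
      have h2 := hc _ (hmem w)
      have h3 : 0 ≤ ρ * ‖app (matA G M) (I.xag (n + 1 + 1) w)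
        + app (matB G M) (I.zag (n + 1 + 1) w)‖ := by positivity
      simp only [gap]
      linarith
    rw [Real.norm_eq_abs, abs_le]
    simp only [Pi.add_apply]
    constructor
    · linarith [neg_abs_le (c - obj g h xs), abs_nonneg ((K + N w) / (((n : ℝ) + 1) * (n + 2)))]
    · linarith [hupper w, le_abs_self ((K + N w) / (((n : ℝ) + 1) * (n + 2))),
        abs_nonneg (c - obj g h xs)]
  refine ⟨hmem, hrun.bddAbove_dualDist hdata.bounded hpen ρ (n + 1), hint, ?_⟩
  -- The weight `2(j+1)` times the noise bound `σ²/(2√(j+3))` is the summand of `sum_div_sqrt_le`,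
  -- the source of the constant `2/3`.
  have hNle : ∫ w, N w ∂μ ≤ σ ^ 2 * (2 / 3 * ((n : ℝ) + 1) * √((n : ℝ) + 2)) := by
    rw [hN, integral_finsetSum _ fun j _ => (hnoise j).1.const_mul _]
    have h1 : ∀ j ∈ Finset.range (n + 1),
        ∫ w, 2 * ((j : ℝ) + 1) * noise g gt ξ I xs j w ∂μ
          ≤ σ ^ 2 * (((j : ℝ) + 1) / √((j : ℝ) + 3)) := by
      intro j _
      rw [integral_const_mul]
      refine (mul_le_mul_of_nonneg_left (hnoise j).2 (by positivity)).trans_eq ?_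
      field_simp
    refine (Finset.sum_le_sum h1).trans ?_
    rw [← Finset.mul_sum]
    refine mul_le_mul_of_nonneg_left ((sum_div_sqrt_le (n + 1)).trans_eq ?_) (sq_nonneg σ)
    push_cast
    ring_nf
  have hmono := integral_mono hint hUint hupper
  rw [integral_div, integral_add (integrable_const K) hNint] at hmono
  simp only [integral_const, probReal_univ, one_smul] at hmono
  have hrate := rate_le n (d := dZ D pen ^ 2 + dLam pen ρ (dualIterates I (n + 1)) ^ 2)
    (o := (⨆ i, om i) * dX D ^ 2) (e := dX D ^ 2) (s := σ ^ 2) (by positivity)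
    (mul_nonneg (Real.iSup_nonneg hom) (sq_nonneg _)) (sq_nonneg _)
  have hcast : ((n + 1 : ℕ) : ℝ) + 1 = (n : ℝ) + 2 := by push_cast; ring
  rw [hcast, Nat.cast_succ]
  refine hmono.trans (le_trans ?_ hrate)
  rw [← hK]
  gcongr
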